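/- **Setting.** Let $X$ be a compact Hausdorff space and let $A\subseteq C(X)$ be a hypo-Dirichlet algebra. That is, $A$ is a subalgebra of $C(X)$ that contains the constants and separates the points of $X$, and there are finitely many invertible elements $g_1,\dots,g_s$ of $A$ such that the real linear span of $\operatorname{Re}A$ and $\log|g_1|,\dots,\log|g_s|$ is uniformly dense in the real continuous functions on $X$. Let $\varphi$ be a (nonzero) multiplicative linear functional on $A$, and let $\mathcal M(\varphi)$ be the convex set of its representing measures, i.e. of the positive regular Borel measures $\mu$ on $X$ with $\varphi(f)=\int_X f\,d\mu$ for all $f\in A$. Let $m\in\mathcal M(\varphi)$ be a core measure: whenever $\nu$ is a finite signed measure with $m+\nu\in\mathcal M(\varphi)$, one has $m-\varepsilon\nu\in\mathcal M(\varphi)$ for all sufficiently small $\varepsilon>0$. Let $H^2(m)$ be the closure of $A$ in $L^2(m)$, let $H^\infty(m)$ be the weak-star closure of $A$ in $L^\infty(m)$, and for $h\in H^\infty(m)$ let $T_h\in B(H^2(m))$ be the operator of multiplication by $h$. Assume that $H^2(m)$ is a reproducing kernel Hilbert space: for some set $\Lambda$ of nonzero multiplicative linear functionals on $A$, every evaluation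 $a\mapsto\lambda(a)$ $(a\in A,\ \lambda\in\Lambda)$ extends to a bounded linear functional on $H^2(m)$, and these functionals together separate the points of $H^2(m)$. **Proposition 3.3.** Let $\mathcal A\subseteq B(H^2(m))$ be a subalgebra containing $\{T_h : h\in H^\infty(m)\}$, let $\mathcal D$ be a dense linear subspace (not necessarily closed) of $H^2(m)$ with $B\mathcal D\subseteq\mathcal D$ for all $B\in\mathcal A$, and let $T:\mathcal D\to H^2(m)$ be a map, not assumed to be linear, such that $TBf=BTf$ for all $f\in\mathcal D$ and $B\in\mathcal A$. Then there exist $f_1,f_2\in H^\infty(m)$, with $f_2\neq 0$ $m$-almost everywhere, such that $$Tf=\frac{f_1}{f_2}\,f\quad m\text{-almost everywhere, for every } f\in\mathcal D .$$ Moreover, $T$ is linear and closable, i.e. the closure of its graph in $H^2(m)\times H^2(m)$ is the graph of a linear operator. -/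

import Mathlib

open MeasureTheory Topology
open scoped ENNReal

noncomputable section

namespace HypoDirichlet

section Algebra

variable {X : Type*} [TopologicalSpace X]

/-- The algebra `A ⊆ C(X)` (which contains the constants, being a unital subalgebra) is a uniform
algebra on `X`: it separates the points of `X`. -/
def IsUniformAlgebra (A : Subalgebra ℂ C(X, ℂ)) : Prop :=
  A.SeparatesPoints

/-- `Re A`, as a subset of the real-valued continuous functions. -/
def reSet (A : Subalgebra ℂ C(X, ℂ)) : Set C(X, ℝ) :=
  {u | ∃ a ∈ A, ∀ x, u x = (a x).re}

/-- `A` is a hypo-Dirichlet algebra: it is a uniform algebra and there are finitely many invertible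
elements `f₁, …, fₛ` of `A` such that the real linear span of `Re A` and
`log |f₁|, …, log |fₛ|` is uniformly dense in the real-valued continuous functions.
(The invariant `s` of `A` is the least length of such a list.) -/
def IsHypoDirichlet [CompactSpace X] (A : Subalgebra ℂ C(X, ℂ)) : Prop :=
  IsUniformAlgebra A ∧
  ∃ (s : ℕ) (f : Fin s → (↥A)ˣ),
    Dense (Submodule.span ℝ
      (reSet A ∪ {u : C(X, ℝ) | ∃ i, ∀ x, u x = Real.log ‖((f i : ↥A) : C(X, ℂ)) x‖}) :
        Set C(X, ℝ))

end Algebra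

/-- `x` is a core point of the subset `K` of a real vector space. -/
def IsCorePoint {V : Type*} [AddCommGroup V] [Module ℝ V] (K : Set V) (x : V) : Prop :=
  x ∈ K ∧ ∀ y, x + y ∈ K → ∃ ε₀ : ℝ, 0 < ε₀ ∧ ∀ ε : ℝ, 0 < ε → ε < ε₀ → x - ε • y ∈ K

variable {X : Type*} [TopologicalSpace X] [CompactSpace X] [MeasurableSpace X] [BorelSpace X]

/-- `m` is a representing measure for the multiplicative functional `φ` on `A`: a positive regular
Borel measure with `φ f = ∫ f dm` for `f ∈ A`. -/
structure IsRepresentingMeasure (A : Subalgebra ℂ C(X, ℂ)) (φ : ↥A →ₐ[ℂ] ℂ) (m : Measure X) :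
    Prop where
  regular : m.Regular
  integral_eq : ∀ f : ↥A, φ f = ∫ x, (f : C(X, ℂ)) x ∂m

/-- The set `𝓜(φ)` of representing measures for `φ`, inside the real vector space of finite signed
Borel measures. -/
def representingMeasures (A : Subalgebra ℂ C(X, ℂ)) (φ : ↥A →ₐ[ℂ] ℂ) : Set (SignedMeasure X) :=
  {ν | ∃ (μ : Measure X) (_ : IsFiniteMeasure μ),
    IsRepresentingMeasure A φ μ ∧ ν = μ.toSignedMeasure}

/-- `m` is a core measure for `φ`: a representing measure that is a core point of `𝓜(φ)`. -/
def IsCoreMeasure (A : Subalgebra ℂ C(X, ℂ)) (φ : ↥A →ₐ[ℂ] ℂ) (m : Measure X)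
    [IsFiniteMeasure m] : Prop :=
  IsRepresentingMeasure A φ m ∧ IsCorePoint (representingMeasures A φ) m.toSignedMeasure

/-- `H²(m)`: the closure of `A` in `L²(m)`. -/
def H2 (A : Subalgebra ℂ C(X, ℂ)) (m : Measure X) [IsFiniteMeasure m] :
    Submodule ℂ (Lp ℂ 2 m) :=
  ((Subalgebra.toSubmodule A).map (ContinuousMap.toLp 2 m ℂ).toLinearMap).topologicalClosure

/-- The element of `H²(m)` given by an element of `A`. -/
def toH2 (A : Subalgebra ℂ C(X, ℂ)) (m : Measure X) [IsFiniteMeasure m] (a : ↥A) : ↥(H2 A m) :=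
  ⟨ContinuousMap.toLp 2 m ℂ (a : C(X, ℂ)),
    Submodule.le_topologicalClosure _ ⟨(a : C(X, ℂ)), a.2, rfl⟩⟩

/-- The weak-star topology of `L^∞(m) = (L¹(m))*`: the coarsest topology making
`h ↦ ∫ h g dm` continuous for every `g ∈ L¹(m)`. -/
@[reducible] def weakStarTopology (m : Measure X) : TopologicalSpace (Lp ℂ ∞ m) :=
  TopologicalSpace.induced (fun (h : Lp ℂ ∞ m) (g : Lp ℂ 1 m) => ∫ x, h x * g x ∂m)
    Pi.topologicalSpace

/-- `H^∞(m)`: the weak-star closure of `A` in `L^∞(m)`. -/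
def HInfty (A : Subalgebra ℂ C(X, ℂ)) (m : Measure X) [IsFiniteMeasure m] : Set (Lp ℂ ∞ m) :=
  closure[weakStarTopology m] ((fun a : C(X, ℂ) => ContinuousMap.toLp ∞ m ℂ a) '' (A : Set C(X, ℂ)))

/-- `{T_h ∈ B(H²(m)) | h ∈ H^∞(m)}`: the bounded operators on `H²(m)` that are multiplication by
some `h ∈ H^∞(m)`. -/
def multiplicationOperators (A : Subalgebra ℂ C(X, ℂ)) (m : Measure X) [IsFiniteMeasure m] :
    Set (↥(H2 A m) →L[ℂ] ↥(H2 A m)) :=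
  {B | ∃ h ∈ HInfty A m, ∀ f : ↥(H2 A m),
    ((B f : Lp ℂ 2 m) : X → ℂ) =ᵐ[m] fun x => h x * (f : Lp ℂ 2 m) x}

/-- `H²(m)` is a reproducing kernel Hilbert space: it is (injectively, with continuous point
evaluations) a space of functions on a set `Λ` of points of the maximal ideal space `M_A` of `A`,
where the function attached to `a ∈ A` is its Gelfand transform `ψ ↦ ψ a`. -/
def IsReproducingKernelHilbertSpace (A : Subalgebra ℂ C(X, ℂ)) (m : Measure X)
    [IsFiniteMeasure m] : Prop :=
  ∃ (Λ : Set (↥A →ₐ[ℂ] ℂ)) (r : RKHS ℂ ↥(H2 A m) ↥Λ ℂ),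
    ∀ (a : ↥A) (ψ : ↥Λ), r.coeCLM (toH2 A m a) ψ = (ψ : ↥A →ₐ[ℂ] ℂ) a

end HypoDirichlet

end

noncomputable section

set_option linter.unusedSectionVars false

namespace HypoDirichlet

/-! ### Log-moduli of units and approximation by integer exponents. -/

section LogModulus

variable {B : Type*} [NormedCommRing B] [NormedAlgebra ℂ B]

/-! If `f₀` lies in `D` and vanishes almost nowhere, then `T` should be multiplication by `T f₀ /
f₀`: this follows from `f · T g = g · T f` on `D`, and that identity would be immediate if `f` and
`g` were bounded, since multiplication by them would then commute with `T`. Two facts make this work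
for unbounded functions.

Non-vanishing (`ae_ne_zero_of_integral_ne_zero`): a function of `H²(m)` with non-zero mean is
non-zero almost everywhere. By `exists_capacity_pos`, a set of positive measure has positive
capacity. If `f` vanished on such a set, there would be units `h` of the uniform closure, huge near
that set and bounded elsewhere, with `∫ h` growing exponentially while `∫ f h = ∫ f · ∫ h` stays
bounded. Units come from the hypo-Dirichlet condition; the exponents of the `gᵢ` have to be rounded
to integers, at a bounded cost.

Common denominators (`exists_common_denominator`): for an integrable weight `w ≥ 1`, the solution
`G` of a least-norm problem in `L²(w m)` makes `|G|² w m` a multiple of a representing measure. A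
core measure dominates all representing measures with one constant, so `|G|² w` is bounded. With `w
= 1 + |f|² + |g|²` both `G f` and `G g` are bounded, and `G` has mean `1`, hence is non-zero almost
everywhere and can be cancelled.

The same extremal functions, for weights tending to `1`, show that bounded functions of `H²(m)` lie
in `H^∞(m)` (`mem_HInfty_of_mem_H2`). So multiplication by `G f` and `G g` is in the algebra, and
the quotient obtained has numerator and denominator in `H^∞(m)`. -/

/-- The value at the character `χ` of the formal function `Re a + ∑ cᵢ log |gᵢ|`. -/
def logModulus {s : ℕ} (g : Fin s → Bˣ) (a : B) (c : Fin s → ℝ) (χ : B →ₐ[ℂ] ℂ) : ℝ :=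
  (χ a).re + ∑ i, c i * Real.log ‖χ (g i)‖

lemma logModulus_add {s : ℕ} (g : Fin s → Bˣ) (a b : B) (c d : Fin s → ℝ) (χ : B →ₐ[ℂ] ℂ) :
    logModulus g (a + b) (c + d) χ = logModulus g a c χ + logModulus g b d χ := by
  simp only [logModulus, map_add, Complex.add_re, Pi.add_apply, add_mul, Finset.sum_add_distrib]
  ring

lemma logModulus_smul {s : ℕ} (g : Fin s → Bˣ) (a : B) (c : Fin s → ℝ) (t : ℝ)
    (χ : B →ₐ[ℂ] ℂ) :
    logModulus g ((t : ℂ) • a) (t • c) χ = t * logModulus g a c χ := by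
  simp only [logModulus, map_smul, smul_eq_mul, Complex.re_ofReal_mul, Pi.smul_apply, mul_add,
    Finset.mul_sum, mul_assoc]

lemma logModulus_sub {s : ℕ} (g : Fin s → Bˣ) (a b : B) (c d : Fin s → ℝ) (χ : B →ₐ[ℂ] ℂ) :
    logModulus g (a - b) (c - d) χ = logModulus g a c χ - logModulus g b d χ := by
  simp only [logModulus, map_sub, Complex.sub_re, Pi.sub_apply, sub_mul, Finset.sum_sub_distrib]
  ring

lemma logModulus_sum {s : ℕ} (g : Fin s → Bˣ) {ι : Type*} (S : Finset ι) (a : ι → B)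
    (c : ι → Fin s → ℝ) (χ : B →ₐ[ℂ] ℂ) :
    logModulus g (∑ j ∈ S, a j) (∑ j ∈ S, c j) χ = ∑ j ∈ S, logModulus g (a j) (c j) χ := by
  classical
  induction S using Finset.induction_on with
  | empty => simp [logModulus]
  | insert j S hj ih => rw [Finset.sum_insert hj, Finset.sum_insert hj, Finset.sum_insert hj,
      logModulus_add, ih]

lemma map_unit_ne_zero (χ : B →ₐ[ℂ] ℂ) (g : Bˣ) : χ (g : B) ≠ 0 :=
  ((g.isUnit).map χ).ne_zero

lemma norm_map_inv (χ : B →ₐ[ℂ] ℂ) (g : Bˣ) :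
    ‖χ ((g⁻¹ : Bˣ) : B)‖ = ‖χ (g : B)‖⁻¹ := by
  have h : χ (g : B) * χ ((g⁻¹ : Bˣ) : B) = 1 := by rw [← map_mul]; simp
  rw [eq_inv_of_mul_eq_one_right h, norm_inv]

/-- Contractivity at `g` bounds the logarithm above, at `g⁻¹` below. The bound does not depend on
`χ`, so a rounding error in the exponents has uniformly bounded effect. -/
lemma abs_log_norm_map_unit_le (χ : B →ₐ[ℂ] ℂ) (hχ : ∀ f, ‖χ f‖ ≤ ‖f‖) (g : Bˣ) :
    |Real.log ‖χ g‖| ≤ |Real.log ‖(g : B)‖| + |Real.log ‖((g⁻¹ : Bˣ) : B)‖| := by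
  have h1 : Real.log ‖χ g‖ ≤ Real.log ‖(g : B)‖ :=
    Real.log_le_log (norm_pos_iff.2 (map_unit_ne_zero χ g)) (hχ _)
  have h2 : - Real.log ‖χ g‖ ≤ Real.log ‖((g⁻¹ : Bˣ) : B)‖ := by
    rw [← Real.log_inv, ← norm_map_inv]
    exact Real.log_le_log (norm_pos_iff.2 (map_unit_ne_zero χ _)) (hχ _)
  rw [abs_le]
  constructor
  · linarith [le_abs_self (Real.log ‖((g⁻¹ : Bˣ) : B)‖), abs_nonneg (Real.log ‖(g : B)‖)]
  · linarith [abs_nonneg (Real.log ‖((g⁻¹ : Bˣ) : B)‖), le_abs_self (Real.log ‖(g : B)‖)]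

lemma norm_map_exp [CompleteSpace B] (χ : B →ₐ[ℂ] ℂ) (hχ : ∀ f, ‖χ f‖ ≤ ‖f‖) (a : B) :
    ‖χ (NormedSpace.exp a)‖ = Real.exp (χ a).re := by
  let _ : NormedAlgebra ℚ B := NormedAlgebra.restrictScalars ℚ ℂ B
  have hc : Continuous χ := by
    have : LipschitzWith 1 χ := LipschitzWith.of_dist_le_mul fun x y => by
      rw [dist_eq_norm, dist_eq_norm, ← map_sub]; simpa using hχ (x - y)
    exact this.continuous
  rw [NormedSpace.map_exp χ hc, ← Complex.exp_eq_exp_ℂ, Complex.norm_exp]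

/-- A formal function `Re a + ∑ cᵢ log |gᵢ|` whose coefficients are close to integers is close to
the log-modulus of an invertible element, uniformly over all contractive characters. -/
theorem exists_unit_log_norm_near [CompleteSpace B] {s : ℕ} (g : Fin s → Bˣ) :
    ∃ R : ℝ, 0 ≤ R ∧ ∀ (a : B) (c : Fin s → ℝ) (δ : ℝ),
      (∀ i, ∃ k : ℤ, |c i - k| ≤ δ) → ∃ h : Bˣ, ∀ χ : B →ₐ[ℂ] ℂ, (∀ f, ‖χ f‖ ≤ ‖f‖) →
        |Real.log ‖χ h‖ - logModulus g a c χ| ≤ δ * R := by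
  refine ⟨∑ i, (|Real.log ‖(g i : B)‖| + |Real.log ‖(((g i)⁻¹ : Bˣ) : B)‖|),
    Finset.sum_nonneg fun i _ => by positivity, fun a c δ hc => ?_⟩
  choose k hk using hc
  let _ : NormedAlgebra ℚ B := NormedAlgebra.restrictScalars ℚ ℂ B
  obtain ⟨e, he⟩ := NormedSpace.isUnit_exp a
  -- The real part is realised exactly by the exponential; only the exponents `c i` are rounded to
  -- the integers `k i`.
  refine ⟨e * ∏ i, g i ^ k i, fun χ hχ => ?_⟩
  have hz : ∀ i, ‖χ ((g i ^ k i : Bˣ) : B)‖ = ‖χ (g i)‖ ^ k i := by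
    intro i
    have : χ ((g i ^ k i : Bˣ) : B) = χ (g i) ^ k i := by
      have := congrArg Units.val (map_zpow (Units.map (χ : B →* ℂ)) (g i) (k i))
      rw [Units.val_zpow_eq_zpow_val] at this
      exact this
    rw [this, norm_zpow]
  have hlog : Real.log ‖χ ((e * ∏ i, g i ^ k i : Bˣ) : B)‖
      = (χ a).re + ∑ i, k i * Real.log ‖χ (g i)‖ := by
    rw [Units.val_mul, map_mul, norm_mul, he, norm_map_exp χ hχ, Units.coe_prod, map_prod,
      norm_prod, Real.log_mul (Real.exp_ne_zero _)
      (Finset.prod_ne_zero_iff.2 fun i _ => norm_ne_zero_iff.2 (map_unit_ne_zero χ _)),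
      Real.log_exp, Real.log_prod fun i _ => norm_ne_zero_iff.2 (map_unit_ne_zero χ _)]
    congr 1
    exact Finset.sum_congr rfl fun i _ => by rw [hz, Real.log_zpow]
  rw [hlog, logModulus, add_sub_add_left_eq_sub, ← Finset.sum_sub_distrib, Finset.mul_sum]
  refine (Finset.abs_sum_le_sum_abs _ _).trans (Finset.sum_le_sum fun i _ => ?_)
  rw [← sub_mul, abs_mul, abs_sub_comm]
  exact mul_le_mul (hk i) (abs_log_norm_map_unit_le χ hχ (g i)) (abs_nonneg _)
    ((abs_nonneg _).trans (hk i))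

lemma exists_int_near (x : ℝ) : ∃ k : ℤ, |x - k| ≤ 1 :=
  ⟨round x, (abs_sub_round x).trans (by norm_num)⟩

/-- Any sequence of vectors has two far members that differ by almost an integer vector. -/
lemma exists_sub_near_int {s : ℕ} (c : ℕ → Fin s → ℝ) {δ : ℝ} (hδ : 0 < δ) (N : ℕ) :
    ∃ j n, N ≤ j ∧ j < n ∧ ∀ i, ∃ k : ℤ, |c n i - c j i - k| ≤ δ := by
  -- The fractional parts stay in a compact cube, so a subsequence of them is Cauchy; two
  -- consecutive late terms of it will do.
  obtain ⟨y, -, ns, hns, hy⟩ := tendsto_subseq_of_bounded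
    (s := Set.Icc (0 : Fin s → ℝ) 1) (Metric.isBounded_Icc _ _)
    (x := fun n i => Int.fract (c n i)) (fun n => ⟨fun i => Int.fract_nonneg _,
      fun i => (Int.fract_lt_one _).le⟩)
  obtain ⟨M, hM⟩ := Metric.cauchySeq_iff.1 hy.cauchySeq δ hδ
  refine ⟨ns (max M N), ns (max M N + 1), (le_max_right _ _).trans (hns.id_le _),
    hns (Nat.lt_succ_self _), fun i =>
    ⟨⌊c (ns (max M N + 1)) i⌋ - ⌊c (ns (max M N)) i⌋, ?_⟩⟩
  have h := hM (max M N + 1) ((le_max_left _ _).trans (Nat.le_succ _)) (max M N) (le_max_left _ _)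
  have h2 := (dist_le_pi_dist _ _ i).trans h.le
  rw [Real.dist_eq] at h2
  refine le_trans (le_of_eq ?_) h2
  simp only [Function.comp, Int.fract]
  push_cast
  congr 1
  ring

end LogModulus

/-! ### Representing measures as characters of the uniform closure, and positivity of capacity. -/

section Capacity

variable {X : Type*} [TopologicalSpace X] [CompactSpace X] [MeasurableSpace X] [BorelSpace X]

lemma integrable_continuousMap (m : Measure X) [IsFiniteMeasure m] (f : C(X, ℂ)) :
    Integrable f m := by
  have h := Lp.memLp (ContinuousMap.toLp 1 m ℂ f)
  rw [memLp_congr_ae (ContinuousMap.coeFn_toLp m f)] at h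
  exact memLp_one_iff_integrable.1 h

lemma continuous_integral_continuousMap (m : Measure X) [IsFiniteMeasure m] :
    Continuous fun f : C(X, ℂ) => ∫ x, f x ∂m := by
  have h : (fun f : C(X, ℂ) => ∫ x, f x ∂m)
      = fun f => ∫ x, (ContinuousMap.toLp 1 m ℂ f) x ∂m := by
    funext f
    exact integral_congr_ae (ContinuousMap.coeFn_toLp m f).symm
  rw [h]
  exact continuous_integral.comp (ContinuousMap.toLp 1 m ℂ).continuous

lemma IsRepresentingMeasure.integral_one {A : Subalgebra ℂ C(X, ℂ)} {φ : ↥A →ₐ[ℂ] ℂ}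
    {m : Measure X} (hm : IsRepresentingMeasure A φ m) : m.real Set.univ = 1 := by
  have h := hm.integral_eq 1
  rw [map_one] at h
  have h2 : (1 : ℂ) = ((m.real Set.univ : ℝ) : ℂ) := by simpa using h
  exact_mod_cast h2.symm

/-- The passage to the uniform closure makes exponentials available: the closure is complete,
whereas `A` need not be. -/
lemma IsRepresentingMeasure.integral_mul_closure {A : Subalgebra ℂ C(X, ℂ)} {φ : ↥A →ₐ[ℂ] ℂ}
    {m : Measure X} [IsFiniteMeasure m] (hm : IsRepresentingMeasure A φ m) {a b : C(X, ℂ)}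
    (ha : a ∈ A.topologicalClosure) (hb : b ∈ A.topologicalClosure) :
    ∫ x, (a * b) x ∂m = (∫ x, a x ∂m) * ∫ x, b x ∂m := by
  have hI := continuous_integral_continuousMap m
  have hab : (a, b) ∈ closure ((A : Set C(X, ℂ)) ×ˢ (A : Set C(X, ℂ))) := by
    rw [closure_prod_eq]; exact ⟨ha, hb⟩
  refine closure_minimal (t := {p : C(X, ℂ) × C(X, ℂ) |
    ∫ x, (p.1 * p.2) x ∂m = (∫ x, p.1 x ∂m) * ∫ x, p.2 x ∂m}) ?_ ?_ hab
  · rintro ⟨a, b⟩ ⟨ha, hb⟩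
    have h1 := hm.integral_eq ⟨a, ha⟩
    have h2 := hm.integral_eq ⟨b, hb⟩
    have h3 := hm.integral_eq (⟨a, ha⟩ * ⟨b, hb⟩)
    rw [map_mul] at h3
    exact h3.symm.trans (by rw [h1, h2])
  · exact isClosed_eq (hI.comp (continuous_fst.mul continuous_snd))
      ((hI.comp continuous_fst).mul (hI.comp continuous_snd))

/-- Integration against a representing measure, as a character of the uniform closure. -/
def IsRepresentingMeasure.closureHom {A : Subalgebra ℂ C(X, ℂ)} {φ : ↥A →ₐ[ℂ] ℂ}
    {m : Measure X} [IsFiniteMeasure m] (hm : IsRepresentingMeasure A φ m) :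
    ↥A.topologicalClosure →ₐ[ℂ] ℂ :=
  AlgHom.ofLinearMap
    { toFun := fun f => ∫ x, (f : C(X, ℂ)) x ∂m
      map_add' := fun f g =>
        integral_add (integrable_continuousMap m f) (integrable_continuousMap m g)
      map_smul' := fun t f => integral_const_mul t _ }
    (by
      have h := hm.integral_one
      change ∫ x, ((1 : ↥A.topologicalClosure) : C(X, ℂ)) x ∂m = 1
      simp [h])
    (fun f g => hm.integral_mul_closure f.2 g.2)

lemma IsRepresentingMeasure.closureHom_apply {A : Subalgebra ℂ C(X, ℂ)} {φ : ↥A →ₐ[ℂ] ℂ}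
    {m : Measure X} [IsFiniteMeasure m] (hm : IsRepresentingMeasure A φ m)
    (f : ↥A.topologicalClosure) : hm.closureHom f = ∫ x, (f : C(X, ℂ)) x ∂m := rfl

lemma IsRepresentingMeasure.norm_closureHom_le {A : Subalgebra ℂ C(X, ℂ)} {φ : ↥A →ₐ[ℂ] ℂ}
    {m : Measure X} [IsFiniteMeasure m] (hm : IsRepresentingMeasure A φ m)
    (f : ↥A.topologicalClosure) {M : ℝ} (hf : ∀ x, ‖(f : C(X, ℂ)) x‖ ≤ M) :
    ‖hm.closureHom f‖ ≤ M := by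
  have h := norm_integral_le_of_norm_le_const (μ := m) (Filter.Eventually.of_forall hf)
  rwa [hm.integral_one, mul_one] at h

/-- Evaluation at a point, as a character. -/
def evalHom (B : Subalgebra ℂ C(X, ℂ)) (x : X) : ↥B →ₐ[ℂ] ℂ :=
  (ContinuousMap.evalAlgHom ℂ ℂ x).comp B.val

lemma evalHom_apply (B : Subalgebra ℂ C(X, ℂ)) (x : X) (f : ↥B) :
    evalHom B x f = (f : C(X, ℂ)) x := rfl

lemma norm_evalHom_le (B : Subalgebra ℂ C(X, ℂ)) (x : X) (f : ↥B) : ‖evalHom B x f‖ ≤ ‖f‖ :=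
  ContinuousMap.norm_coe_le_norm (f : C(X, ℂ)) x

variable {A : Subalgebra ℂ C(X, ℂ)} {φ : ↥A →ₐ[ℂ] ℂ} {m : Measure X} [IsFiniteMeasure m]

instance (A : Subalgebra ℂ C(X, ℂ)) : CompleteSpace ↥A.topologicalClosure :=
  A.isClosed_topologicalClosure.completeSpace_coe

/-- The capacity of a set of positive measure with respect to the functional attached to `m` is
positive. -/
theorem exists_capacity_pos [T2Space X] (hm : IsRepresentingMeasure A φ m) {s : ℕ}
    (g : Fin s → (↥A.topologicalClosure)ˣ) {K : Set X} (hK : IsCompact K) (hmK : m K ≠ 0) :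
    ∃ η : ℝ, 0 < η ∧ ∀ (a : ↥A.topologicalClosure) (c : Fin s → ℝ),
      (∀ x, 0 ≤ logModulus g a c (evalHom _ x)) →
      (∀ x ∈ K, 1 ≤ logModulus g a c (evalHom _ x)) → η ≤ logModulus g a c hm.closureHom := by
  by_contra! hcon
  have hpos : ∀ j : ℕ, (0 : ℝ) < (1 / 4) ^ j := fun j => by positivity
  choose a c h0 h1 hlt using fun j => hcon _ (hpos j)
  obtain ⟨R, hR, H⟩ := exists_unit_log_norm_near g
  -- With weights `2 ^ j` the values at `hm.closureHom` stay summable, being below `(1/2) ^ j`,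
  -- while the `j`-th term is at least `2 ^ j` on `K`.
  set aS : ℕ → ↥A.topologicalClosure := fun n => ∑ j ∈ Finset.range n, (((2 : ℝ) ^ j : ℝ) : ℂ) • a j
  set cS : ℕ → Fin s → ℝ := fun n => ∑ j ∈ Finset.range n, ((2 : ℝ) ^ j) • c j
  have hdiff : ∀ j n, j < n → ∀ χ, logModulus g (aS n - aS j) (cS n - cS j) χ
      = ∑ i ∈ Finset.Ico j n, 2 ^ i * logModulus g (a i) (c i) χ := by
    intro j n hjn χ
    rw [logModulus_sub, logModulus_sum, logModulus_sum, Finset.sum_Ico_eq_sub _ hjn.le]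
    simp only [logModulus_smul]
  -- The block of the weighted series from `j` to `n` is nearly `log |u|` for a unit `u`. Then `u⁻¹`
  -- is at most about `1` everywhere and tiny on `K`, yet its mean is nearly `1` in modulus;
  -- comparing the mean with the integrals over `K` and `Kᶜ` gives the inequality.
  have key : ∀ N : ℕ, 1 ≤ Real.exp (2 * (R / (N + 1)) + 2 * (1 / 2) ^ N) *
      (m.real Kᶜ + Real.exp (-2 ^ N) * m.real K) := by
    intro N
    -- Differences of partial sums are used because their coefficients can be made nearly integral;
    -- the rounding error then tends to `0`.
    obtain ⟨j, n, hNj, hjn, hint⟩ := exists_sub_near_int cS (δ := 1 / ((N : ℝ) + 1))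
      (by positivity) N
    obtain ⟨u, hu⟩ := H (aS n - aS j) (cS n - cS j) _ hint
    have hε : 1 / ((N : ℝ) + 1) * R = R / (N + 1) := by ring
    rw [hε] at hu
    have hnn : ∀ x, 0 ≤ logModulus g (aS n - aS j) (cS n - cS j) (evalHom _ x) := fun x => by
      rw [hdiff j n hjn]
      exact Finset.sum_nonneg fun i _ => mul_nonneg (by positivity) (h0 i x)
    have hKl : ∀ x ∈ K, 2 ^ N ≤ logModulus g (aS n - aS j) (cS n - cS j) (evalHom _ x) := by
      intro x hx
      rw [hdiff j n hjn]
      calc (2 : ℝ) ^ N ≤ 2 ^ j * 1 := by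
            rw [mul_one]; exact pow_le_pow_right₀ (by norm_num) hNj
        _ ≤ 2 ^ j * logModulus g (a j) (c j) (evalHom _ x) := by gcongr; exact h1 j x hx
        _ ≤ _ := Finset.single_le_sum
            (f := fun i => (2 : ℝ) ^ i * logModulus g (a i) (c i) (evalHom _ x))
            (fun i _ => mul_nonneg (by positivity) (h0 i x)) (Finset.mem_Ico.2 ⟨le_rfl, hjn⟩)
    have hψ : logModulus g (aS n - aS j) (cS n - cS j) hm.closureHom ≤ 2 * (1 / 2) ^ N := by
      rw [hdiff j n hjn]
      calc ∑ i ∈ Finset.Ico j n, (2 : ℝ) ^ i * logModulus g (a i) (c i) hm.closureHom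
          ≤ ∑ i ∈ Finset.Ico j n, (1 / 2 : ℝ) ^ i := by
            refine Finset.sum_le_sum fun i _ => ?_
            calc (2 : ℝ) ^ i * logModulus g (a i) (c i) hm.closureHom ≤ 2 ^ i * (1 / 4) ^ i := by
                  gcongr; exact (hlt i).le
              _ = (1 / 2) ^ i := by rw [← mul_pow]; norm_num
        _ ≤ (1 / 2) ^ j / (1 - 1 / 2) := geom_sum_Ico_le_of_lt_one (by norm_num) (by norm_num)
        _ = 2 * (1 / 2) ^ j := by ring
        _ ≤ _ := by gcongr ?_ * ?_; exact pow_le_pow_of_le_one (by norm_num) (by norm_num) hNj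
    set f : ↥A.topologicalClosure := ((u⁻¹ : (↥A.topologicalClosure)ˣ) : ↥A.topologicalClosure)
    have hf : ∀ x, ‖(f : C(X, ℂ)) x‖ ≤
        Real.exp (R / (N + 1) - logModulus g (aS n - aS j) (cS n - cS j) (evalHom _ x)) := by
      intro x
      have h2 := (abs_le.1 (hu (evalHom _ x) (norm_evalHom_le _ x))).1
      rw [← evalHom_apply, norm_map_inv, inv_le_comm₀ (norm_pos_iff.2 (map_unit_ne_zero _ _))
        (Real.exp_pos _), ← Real.exp_neg, ← Real.le_log_iff_exp_le
        (norm_pos_iff.2 (map_unit_ne_zero _ _))]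
      linarith
    have hlow : Real.exp (-(R / (N + 1) + 2 * (1 / 2) ^ N)) ≤ ‖hm.closureHom f‖ := by
      have h2 := (abs_le.1 (hu hm.closureHom fun f => hm.norm_closureHom_le f
        fun x => ContinuousMap.norm_coe_le_norm (f : C(X, ℂ)) x)).2
      rw [norm_map_inv, le_inv_comm₀ (Real.exp_pos _) (norm_pos_iff.2 (map_unit_ne_zero _ _)),
        ← Real.exp_neg, neg_neg, ← Real.log_le_iff_le_exp
        (norm_pos_iff.2 (map_unit_ne_zero _ _))]
      linarith
    have hup : ‖hm.closureHom f‖ ≤ Real.exp (R / (N + 1)) * m.real Kᶜ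
        + Real.exp (R / (N + 1) - 2 ^ N) * m.real K := by
      rw [hm.closureHom_apply, ← integral_add_compl hK.measurableSet
        (integrable_continuousMap m f), add_comm]
      refine (norm_add_le _ _).trans (add_le_add ?_ ?_)
      · refine norm_setIntegral_le_of_norm_le_const (measure_lt_top _ _) fun x _ =>
          (hf x).trans (Real.exp_le_exp.2 ?_)
        linarith [hnn x]
      · refine norm_setIntegral_le_of_norm_le_const (measure_lt_top _ _) fun x hx =>
          (hf x).trans (Real.exp_le_exp.2 ?_)
        linarith [hKl x hx]
    have h3 := mul_le_mul_of_nonneg_left (hlow.trans hup)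
      (Real.exp_pos (R / (N + 1) + 2 * (1 / 2) ^ N)).le
    rw [← Real.exp_add, add_neg_cancel, Real.exp_zero] at h3
    refine h3.trans (le_of_eq ?_)
    rw [show 2 * (R / ((N : ℝ) + 1)) + 2 * (1 / 2) ^ N
      = (R / (N + 1) + 2 * (1 / 2) ^ N) + R / (N + 1) by ring, Real.exp_add (_ + _) (R / _),
      sub_eq_add_neg, Real.exp_add (R / _) (- _)]
    ring
  have hlim : Filter.Tendsto (fun N : ℕ => Real.exp (2 * (R / (N + 1)) + 2 * (1 / 2) ^ N) *
      (m.real Kᶜ + Real.exp (-2 ^ N) * m.real K)) Filter.atTop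
      (𝓝 (Real.exp (2 * 0 + 2 * 0) * (m.real Kᶜ + 0 * m.real K))) := by
    have t1 : Filter.Tendsto (fun N : ℕ => R / ((N : ℝ) + 1)) Filter.atTop (𝓝 0) :=
      tendsto_const_nhds.div_atTop
        (Filter.tendsto_atTop_add_const_right _ _ tendsto_natCast_atTop_atTop)
    have t2 : Filter.Tendsto (fun N : ℕ => (1 / 2 : ℝ) ^ N) Filter.atTop (𝓝 0) :=
      tendsto_pow_atTop_nhds_zero_of_lt_one (by norm_num) (by norm_num)
    have t3 : Filter.Tendsto (fun N : ℕ => Real.exp (-2 ^ N)) Filter.atTop (𝓝 0) :=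
      Real.tendsto_exp_neg_atTop_nhds_zero.comp
        (tendsto_pow_atTop_atTop_of_one_lt (by norm_num))
    exact ((Real.continuous_exp.tendsto _).comp ((t1.const_mul 2).add (t2.const_mul 2))).mul
      ((t3.mul_const _).const_add _)
  -- In the limit `1 ≤ m.real Kᶜ`, against `m.real K > 0`.
  have h1le := ge_of_tendsto' hlim key
  have htot := measureReal_add_measureReal_compl (μ := m) hK.measurableSet
  rw [hm.integral_one] at htot
  have hKpos : 0 < m.real K :=
    ENNReal.toReal_pos hmK (measure_ne_top _ _)
  norm_num at h1le
  linarith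

end Capacity

/-! ### Functions of non-zero mean vanish almost nowhere. -/

section Nonvanishing

variable {X : Type*} [TopologicalSpace X] [CompactSpace X] [MeasurableSpace X] [BorelSpace X]
  {A : Subalgebra ℂ C(X, ℂ)} {φ : ↥A →ₐ[ℂ] ℂ} {m : Measure X} [IsFiniteMeasure m]

lemma H2_induction {P : Lp ℂ 2 m → Prop} (hP : IsClosed {f | P f})
    (h : ∀ a ∈ A, P (ContinuousMap.toLp 2 m ℂ a)) {f : Lp ℂ 2 m} (hf : f ∈ H2 A m) : P f := by
  refine closure_minimal (t := {f | P f}) ?_ hP hf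
  rintro _ ⟨a, ha, rfl⟩
  exact h a ha

lemma toLp_mem_H2 {a : C(X, ℂ)} (ha : a ∈ A) : ContinuousMap.toLp 2 m ℂ a ∈ H2 A m :=
  Submodule.le_topologicalClosure _ ⟨a, ha, rfl⟩

lemma continuous_integral_mul {g : X → ℂ} (hg : MemLp g 2 m) :
    Continuous fun f : Lp ℂ 2 m => ∫ x, f x * g x ∂m := by
  have h : (fun f : Lp ℂ 2 m => ∫ x, f x * g x ∂m)
      = fun f => ContinuousLinearMap.lpPairing m 2 2 (ContinuousLinearMap.mul ℂ ℂ) f hg.toLp := by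
    funext f
    rw [ContinuousLinearMap.lpPairing_eq_integral]
    refine integral_congr_ae ?_
    filter_upwards [hg.coeFn_toLp] with x hx
    simp [hx]
  rw [h]
  fun_prop

lemma memLp_continuousMap (p : ℝ≥0∞) (f : C(X, ℂ)) : MemLp f p m := by
  refine MemLp.mono_exponent (q := ∞) ?_ le_top
  have h := Lp.memLp (ContinuousMap.toLp ∞ m ℂ f)
  rwa [memLp_congr_ae (ContinuousMap.coeFn_toLp m f)] at h

/-- For fixed bounded `h` both sides are `L²`-continuous in `f`, so multiplicativity on the closure
of `A` carries over. This lets `f` be tested against units. -/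
lemma integral_mul_of_mem_H2 (hm : IsRepresentingMeasure A φ m) {f : Lp ℂ 2 m}
    (hf : f ∈ H2 A m) {h : C(X, ℂ)} (hh : h ∈ A.topologicalClosure) :
    ∫ x, f x * h x ∂m = (∫ x, f x ∂m) * ∫ x, h x ∂m := by
  refine H2_induction (P := fun f => ∫ x, f x * h x ∂m = (∫ x, f x ∂m) * ∫ x, h x ∂m)
    ?_ ?_ hf
  · refine isClosed_eq (continuous_integral_mul (memLp_continuousMap 2 h)) (Continuous.mul ?_
      continuous_const)
    simpa using continuous_integral_mul (m := m) (memLp_continuousMap 2 (1 : C(X, ℂ)))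
  · intro a ha
    have h1 := hm.integral_mul_closure (A.le_topologicalClosure ha) hh
    have e := ContinuousMap.coeFn_toLp (p := 2) (𝕜 := ℂ) m a
    rw [integral_congr_ae e, ← h1]
    refine integral_congr_ae ?_
    filter_upwards [e] with x hx
    simp only [ContinuousMap.mul_apply, hx]

/-- In a hypo-Dirichlet algebra every real continuous function is close to some
`Re a + ∑ cᵢ log |gᵢ|`, for fixed units `gᵢ` of the uniform closure. -/
lemma IsHypoDirichlet.exists_logModulus_near (hA : IsHypoDirichlet A) :
    ∃ (s : ℕ) (g : Fin s → (↥A.topologicalClosure)ˣ), ∀ (u : C(X, ℝ)) (ε : ℝ), 0 < ε →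
      ∃ (a : ↥A.topologicalClosure) (c : Fin s → ℝ),
        ∀ x, |logModulus g a c (evalHom _ x) - u x| < ε := by
  obtain ⟨-, s, f, hdense⟩ := hA
  refine ⟨s, fun i => Units.map
    (Subalgebra.inclusion A.le_topologicalClosure : ↥A →* ↥A.topologicalClosure) (f i),
    fun u ε hε => ?_⟩
  set g : Fin s → (↥A.topologicalClosure)ˣ := fun i => Units.map
    (Subalgebra.inclusion A.le_topologicalClosure : ↥A →* ↥A.topologicalClosure) (f i) with hg
  obtain ⟨v, hv, huv⟩ := Metric.dense_iff.1 hdense u ε hε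
  have hv' : ∃ (a : ↥A.topologicalClosure) (c : Fin s → ℝ),
      ∀ x, v x = logModulus g a c (evalHom _ x) := by
    refine Submodule.span_induction
      (p := fun v _ => ∃ (a : ↥A.topologicalClosure) (c : Fin s → ℝ),
        ∀ x, v x = logModulus g a c (evalHom _ x)) ?_ ?_ ?_ ?_ huv
    · rintro v (⟨a, ha, hva⟩ | ⟨i, hi⟩)
      · refine ⟨⟨a, A.le_topologicalClosure ha⟩, 0, fun x => ?_⟩
        simp [logModulus, hva, evalHom_apply]
      · refine ⟨0, Pi.single i 1, fun x => ?_⟩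
        have : ∀ j, (Pi.single i (1 : ℝ) : Fin s → ℝ) j
            * Real.log ‖evalHom A.topologicalClosure x (g j)‖
            = if j = i then Real.log ‖evalHom A.topologicalClosure x (g j)‖ else 0 := by
          intro j
          by_cases h : j = i
          · subst h; simp
          · simp [h]
        simp only [logModulus, this, map_zero, Complex.zero_re, zero_add, Finset.sum_ite_eq',
          Finset.mem_univ, if_true]
        exact hi x
    · exact ⟨0, 0, fun x => by simp [logModulus]⟩
    · rintro v w - - ⟨a, c, h⟩ ⟨b, d, h'⟩
      exact ⟨a + b, c + d, fun x => by rw [logModulus_add, ← h, ← h']; rfl⟩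
    · rintro t v - ⟨a, c, h⟩
      exact ⟨(t : ℂ) • a, t • c, fun x => by rw [logModulus_smul, ← h]; rfl⟩
  obtain ⟨a, c, hac⟩ := hv'
  refine ⟨a, c, fun x => ?_⟩
  rw [← hac, ← Real.dist_eq]
  exact (ContinuousMap.dist_apply_le_dist x).trans_lt (Metric.mem_ball.1 hv)

/-- A compact set on which an integrable function vanishes has neighbourhoods over which its
integral is small. -/
lemma exists_isOpen_setIntegral_norm_le [m.Regular] [T2Space X] {f : X → ℂ} (hf : Integrable f m)
    {K : Set X} (hK : IsCompact K) (h0 : ∀ x ∈ K, f x = 0) {ε : ℝ} (hε : 0 < ε) :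
    ∃ U, IsOpen U ∧ K ⊆ U ∧ ∫ x in U, ‖f x‖ ∂m ≤ ε := by
  obtain ⟨δ, hδ, h⟩ := exists_pos_setLIntegral_lt_of_measure_lt (μ := m)
    (f := fun x => ‖f x‖ₑ) hf.2.ne (ENNReal.ofReal_pos.2 hε).ne'
  obtain ⟨U, hKU, hU, hlt⟩ := K.exists_isOpen_lt_add (measure_ne_top m K) hδ.ne'
  refine ⟨U, hU, hKU, ?_⟩
  have hd : m (U \ K) < δ := by
    rw [measure_sdiff hKU hK.measurableSet.nullMeasurableSet (measure_ne_top _ _)]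
    exact ENNReal.sub_lt_of_lt_add (measure_mono hKU) (by rwa [add_comm])
  have h1 : ∫ x in U, ‖f x‖ ∂m = ∫ x in U \ K, ‖f x‖ ∂m := by
    refine (setIntegral_eq_of_subset_of_forall_sdiff_eq_zero hU.measurableSet
      Set.sdiff_subset fun x hx => ?_)
    have : x ∈ K := by by_contra hxK; exact hx.2 ⟨hx.1, hxK⟩
    simp [h0 x this]
  rw [h1, integral_norm_eq_lintegral_enorm hf.1.restrict]
  exact ENNReal.toReal_le_of_le_ofReal hε.le (h _ hd).le

/-- For a hypo-Dirichlet algebra, a function in `H²(m)` with non-zero mean vanishes almost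
nowhere. -/
theorem ae_ne_zero_of_integral_ne_zero [T2Space X] (hA : IsHypoDirichlet A)
    (hm : IsRepresentingMeasure A φ m) {f : Lp ℂ 2 m} (hf : f ∈ H2 A m)
    (hf0 : ∫ x, f x ∂m ≠ 0) : ∀ᵐ x ∂m, f x ≠ 0 := by
  have := hm.regular
  have hfi : Integrable f m := (Lp.memLp f).integrable one_le_two
  by_contra hcon
  have hE : m {x | f x = 0} ≠ 0 := by
    intro h
    exact hcon (by rw [ae_iff]; simpa using h)
  have hEm : MeasurableSet {x | f x = 0} :=
    (Lp.stronglyMeasurable f).measurable (measurableSet_singleton 0)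
  obtain ⟨K, hKE, hK, hmK⟩ := hEm.exists_lt_isCompact_of_ne_top (measure_ne_top _ _)
    (pos_iff_ne_zero.2 hE)
  obtain ⟨s, g, happ⟩ := hA.exists_logModulus_near
  obtain ⟨η, hη, hcap⟩ := exists_capacity_pos hm g hK hmK.ne'
  obtain ⟨R, hR, H⟩ := exists_unit_log_norm_near g
  set I := ∫ x, ‖f x‖ ∂m
  -- Test `f` against a unit `h` with `log |h|` near `t v`, where `v` approximates a Urysohn
  -- function `u` for `K` inside `U`. Capacity makes the mean of `h` at least `exp (t η - R)`,
  -- whereas `∫ f h` is bounded independently of `t`.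
  have key : ∀ n : ℕ, ‖∫ x, f x ∂m‖ * Real.exp ((n + 1) * η - R)
      ≤ Real.exp (R + 2) * (I + 1) := by
    intro n
    set t : ℝ := n + 1
    have ht : 0 < t := by positivity
    -- The tolerance `exp (-t)` offsets the growth `exp t` of `|h|` on `U`.
    obtain ⟨U, hU, hKU, hUi⟩ := exists_isOpen_setIntegral_norm_le hfi hK (fun x hx => hKE hx)
      (Real.exp_pos (-t))
    obtain ⟨u, hu0, hu1, hu01⟩ := exists_continuous_zero_one_of_isClosed (s := Uᶜ) (t := K)
      hU.isClosed_compl hK.isClosed (Set.disjoint_compl_left_iff_subset.2 hKU)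
    -- The shift by `1 / t` keeps the approximant above `u`; after scaling by `t` it costs at most
    -- the constant `2`.
    obtain ⟨a, c, hac⟩ := happ (u + ContinuousMap.const X (1 / t)) (1 / t) (by positivity)
    have hac1 : ∀ x, u x ≤ logModulus g a c (evalHom _ x) := fun x => by
      have := (abs_lt.1 (hac x)).1
      simp only [ContinuousMap.add_apply, ContinuousMap.const_apply] at this
      linarith
    have hac2 : ∀ x, logModulus g a c (evalHom _ x) ≤ u x + 2 * (1 / t) := fun x => by
      have := (abs_lt.1 (hac x)).2
      simp only [ContinuousMap.add_apply, ContinuousMap.const_apply] at this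
      linarith
    have hlow := hcap a c (fun x => (hu01 x).1.trans (hac1 x))
      (fun x hx => (hu1 hx).symm.le.trans (hac1 x))
    -- Rounding with error `1` suffices: the resulting `R` is independent of `t` and is beaten by `t
    -- η`.
    obtain ⟨h, hh⟩ := H ((t : ℂ) • a) (t • c) 1 fun i => exists_int_near _
    simp only [logModulus_smul, one_mul] at hh
    have hψ : Real.exp (t * η - R) ≤ ‖∫ x, ((h : ↥A.topologicalClosure) : C(X, ℂ)) x ∂m‖ := by
      rw [← hm.closureHom_apply, ← Real.le_log_iff_exp_le
        (norm_pos_iff.2 (map_unit_ne_zero _ _))]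
      have h2 := (abs_le.1 (hh hm.closureHom fun f => hm.norm_closureHom_le f
        fun x => ContinuousMap.norm_coe_le_norm (f : C(X, ℂ)) x)).1
      have := mul_le_mul_of_nonneg_left hlow ht.le
      linarith
    have hx : ∀ x, ‖((h : ↥A.topologicalClosure) : C(X, ℂ)) x‖
        ≤ Real.exp (R + 2) * Real.exp (t * u x) := by
      intro x
      rw [← evalHom_apply, ← Real.exp_add, ← Real.log_le_iff_le_exp
        (norm_pos_iff.2 (map_unit_ne_zero _ _))]
      have h2 := (abs_le.1 (hh (evalHom _ x) (norm_evalHom_le _ x))).2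
      have h3 := mul_le_mul_of_nonneg_left (hac2 x) ht.le
      have h4 : t * (u x + 2 * (1 / t)) = t * u x + 2 := by field_simp
      linarith
    have hpt : ∀ x, ‖f x * ((h : ↥A.topologicalClosure) : C(X, ℂ)) x‖
        ≤ Real.exp (R + 2) * (‖f x‖ + Real.exp t * U.indicator (fun x => ‖f x‖) x) := by
      intro x
      rw [norm_mul]
      refine (mul_le_mul_of_nonneg_left (hx x) (norm_nonneg _)).trans ?_
      rw [mul_left_comm]
      refine mul_le_mul_of_nonneg_left ?_ (Real.exp_pos _).le
      by_cases hxU : x ∈ U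
      · rw [Set.indicator_of_mem hxU]
        have : Real.exp (t * u x) ≤ Real.exp t :=
          Real.exp_le_exp.2 (mul_le_of_le_one_right ht.le (hu01 x).2)
        have := mul_le_mul_of_nonneg_left this (norm_nonneg (f x))
        linarith [norm_nonneg (f x)]
      · have : u x = 0 := hu0 hxU
        simp [this, hxU]
    have hint : ‖∫ x, f x * ((h : ↥A.topologicalClosure) : C(X, ℂ)) x ∂m‖
        ≤ Real.exp (R + 2) * (I + 1) := by
      have hi2 := (hfi.norm.indicator hU.measurableSet).const_mul (Real.exp t)
      refine (norm_integral_le_of_norm_le ((hfi.norm.add hi2).const_mul _)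
        (Filter.Eventually.of_forall hpt)).trans ?_
      rw [integral_const_mul, integral_add' hfi.norm hi2, integral_const_mul,
        integral_indicator hU.measurableSet]
      refine mul_le_mul_of_nonneg_left (add_le_add_right ?_ _) (Real.exp_pos _).le
      refine (mul_le_mul_of_nonneg_left hUi (Real.exp_pos t).le).trans ?_
      rw [← Real.exp_add, add_neg_cancel, Real.exp_zero]
    rw [integral_mul_of_mem_H2 hm hf (h : ↥A.topologicalClosure).2, norm_mul] at hint
    exact (mul_le_mul_of_nonneg_left hψ (norm_nonneg _)).trans hint
  have hlim : Filter.Tendsto (fun n : ℕ => ‖∫ x, f x ∂m‖ * Real.exp ((n + 1) * η - R))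
      Filter.atTop Filter.atTop := by
    refine Filter.Tendsto.const_mul_atTop (norm_pos_iff.2 hf0) (Real.tendsto_exp_atTop.comp ?_)
    exact Filter.tendsto_atTop_add_const_right _ _ ((Filter.tendsto_atTop_add_const_right _ _
      tendsto_natCast_atTop_atTop).atTop_mul_const hη)
  obtain ⟨n, hn⟩ := (hlim.eventually_gt_atTop (Real.exp (R + 2) * (I + 1))).exists
  exact (key n).not_gt hn

end Nonvanishing

/-! ### Domination of representing measures by a core measure. -/

section Core

variable {X : Type*} [TopologicalSpace X] [CompactSpace X] [MeasurableSpace X] [BorelSpace X]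
  {A : Subalgebra ℂ C(X, ℂ)} {φ : ↥A →ₐ[ℂ] ℂ} {m : Measure X} [IsFiniteMeasure m]

/-- Absolute continuity of the integral transfers inner regularity on open sets from `m`. It
certifies that measures built from densities are representing measures. -/
lemma regular_withDensity [T2Space X] [m.Regular] {ρ : X → ℝ≥0∞}
    (hρ : ∫⁻ x, ρ x ∂m ≠ ∞) : (m.withDensity ρ).Regular := by
  have : IsFiniteMeasure (m.withDensity ρ) := isFiniteMeasure_withDensity hρ
  have : (m.withDensity ρ).InnerRegular := by
    refine ⟨fun U hU r hr => ?_⟩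
    obtain ⟨δ, hδ, h⟩ := exists_pos_setLIntegral_lt_of_measure_lt hρ
      (tsub_pos_of_lt hr).ne'
    obtain ⟨K, hKU, hK, hlt⟩ := hU.exists_isCompact_sdiff_lt (measure_ne_top m _) hδ.ne'
    refine ⟨K, hKU, hK, ?_⟩
    have h1 := h _ hlt
    rw [← withDensity_apply _ (hU.diff hK.measurableSet),
      measure_sdiff hKU hK.measurableSet.nullMeasurableSet (measure_ne_top _ _)] at h1
    by_contra! hcon
    exact h1.not_ge (tsub_le_tsub_left hcon _)
  infer_instance

/-- Positivity of `m - ε (ν - m)` is the inequality `ν ≤ (1 + 1/ε) m`, used here with `ε = ε₀ / 2`.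
-/
lemma IsCoreMeasure.exists_le_smul (hm : IsCoreMeasure A φ m) (ν : Measure X)
    [IsFiniteMeasure ν] (hν : IsRepresentingMeasure A φ ν) :
    ∃ C : NNReal, ν ≤ C • m := by
  obtain ⟨ε₀, hε₀, h⟩ := hm.2.2 (ν.toSignedMeasure - m.toSignedMeasure)
    ⟨ν, inferInstance, hν, by abel⟩
  obtain ⟨μ, _, -, hμ⟩ := h (ε₀ / 2) (by positivity) (by linarith)
  refine ⟨(1 + 2 / ε₀).toNNReal, Measure.le_iff.2 fun s hs => ?_⟩
  have h1 := congrArg (fun τ : SignedMeasure X => τ s) hμ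
  simp only [FunLike.coe_sub, FunLike.coe_smul, Pi.sub_apply, Pi.smul_apply,
    Measure.toSignedMeasure_apply_measurable hs, smul_eq_mul] at h1
  have h2 : ν.real s ≤ (1 + 2 / ε₀) * m.real s := by
    have h3 : 0 ≤ μ.real s := measureReal_nonneg
    rw [← h1] at h3
    have h4 : ε₀ / 2 * ν.real s ≤ ε₀ / 2 * ((1 + 2 / ε₀) * m.real s) := by
      have : ε₀ / 2 * ((1 + 2 / ε₀) * m.real s) = ε₀ / 2 * m.real s + m.real s := by
        field_simp
      linarith
    exact le_of_mul_le_mul_left h4 (by positivity)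
  have h5 := ENNReal.ofReal_le_ofReal h2
  rw [ENNReal.ofReal_mul (by positivity), ofReal_measureReal, ofReal_measureReal] at h5
  exact h5

/-- A core measure dominates all representing measures, with a uniform constant. -/
theorem IsCoreMeasure.exists_forall_le_smul [T2Space X] (hm : IsCoreMeasure A φ m) :
    ∃ C : NNReal, ∀ (ν : Measure X) [IsFiniteMeasure ν], IsRepresentingMeasure A φ ν →
      ν ≤ C • m := by
  by_contra! hcon
  -- The average of the `ν n` with weights `2^{-(n+1)}` is again representing, so lies below some `C
  -- • m`. Hence `ν n ≤ 2^{n+1} C m`, which is below `4^n m` once `2 C < 2^n`.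
  choose ν hfin hν hle using fun n : ℕ => hcon (4 ^ n)
  have hreg := fun n => (hν n).regular
  set c : ℕ → NNReal := fun n => (1 / 2) ^ (n + 1)
  set σ : Measure X := Measure.sum fun n => c n • ν n
  have hcsum : HasSum (fun n => ((c n : NNReal) : ℝ)) 1 := by
    convert hasSum_geometric_two' 1 using 2 with n
    simp only [c]
    push_cast
    rw [pow_succ, one_div_pow]
    ring
  have huniv : ∀ n, ν n Set.univ = 1 := fun n => by
    have := (hν n).integral_one
    rw [measureReal_def, ENNReal.toReal_eq_one_iff] at this
    exact this
  have hσ : σ Set.univ = 1 := by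
    rw [Measure.sum_apply _ MeasurableSet.univ]
    simp only [Measure.smul_apply, huniv]
    have := (ENNReal.hasSum_coe.2 ((NNReal.hasSum_coe (r := 1)).1 (by simpa using hcsum) :
      HasSum c 1)).tsum_eq
    simpa [ENNReal.smul_def] using this
  have : IsFiniteMeasure σ := ⟨by rw [hσ]; exact ENNReal.one_lt_top⟩
  have hσrep : IsRepresentingMeasure A φ σ := by
    have : σ.InnerRegular := inferInstance
    refine ⟨inferInstance, fun f => ?_⟩
    have h1 := hasSum_integral_measure (integrable_continuousMap σ (f : C(X, ℂ)))
    refine (h1.unique ?_).symm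
    have h2 : ∀ n, ∫ x, (f : C(X, ℂ)) x ∂(c n • ν n) = ((c n : ℝ) : ℂ) * φ f := fun n => by
      rw [integral_smul_nnreal_measure, ← (hν n).integral_eq]
      rfl
    simp only [h2]
    have h3 := ((Complex.hasSum_ofReal.2 hcsum).mul_right (φ f))
    simpa using h3
  obtain ⟨C, hC⟩ := hm.exists_le_smul σ hσrep
  obtain ⟨n, hn⟩ := pow_unbounded_of_one_lt (2 * C) (one_lt_two : (1 : NNReal) < 2)
  refine hle n (Measure.le_iff.2 fun s hs => ?_)
  have h1 : (c n : ℝ≥0∞) * ν n s ≤ C * m s :=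
    (Measure.le_sum (fun n => c n • ν n) n s).trans (hC s)
  have h2 : ((2 ^ (n + 1) : NNReal) : ℝ≥0∞) * ((c n : ℝ≥0∞) * ν n s) = ν n s := by
    rw [← mul_assoc, ← ENNReal.coe_mul, ← mul_pow]
    norm_num
  rw [← h2]
  refine (mul_le_mul_right h1 _).trans ?_
  rw [← mul_assoc, ← ENNReal.coe_mul]
  refine mul_le_mul_left ?_ _
  rw [ENNReal.coe_le_coe, pow_succ, mul_assoc, show (4 : NNReal) = 2 * 2 by norm_num, mul_pow]
  exact mul_le_mul_right hn.le _

end Core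

/-! ### A least-norm problem whose solution yields a representing measure. -/

section Extremal

variable {X : Type*} [TopologicalSpace X] [CompactSpace X] [MeasurableSpace X] [BorelSpace X]
  {A : Subalgebra ℂ C(X, ℂ)} {φ : ↥A →ₐ[ℂ] ℂ} {m : Measure X} [IsFiniteMeasure m]

lemma norm_sq_eq_integral {P : Measure X} (f : Lp ℂ 2 P) : ‖f‖ ^ 2 = ∫ x, ‖f x‖ ^ 2 ∂P := by
  have h : (fun x => inner ℂ (f x) (f x)) = fun x => ((‖f x‖ ^ 2 : ℝ) : ℂ) := by
    funext x
    rw [inner_self_eq_norm_sq_to_K]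
    push_cast
    rfl
  rw [← inner_self_eq_norm_sq (𝕜 := ℂ) f, L2.inner_def, h, integral_complex_ofReal]
  rfl

/-- The solution `G` of the weighted extremal problem `inf {∫ |b|² dP : b ∈ A, ∫ b dm = 1}`: the
measure `|G|² dP` is a multiple of a representing measure. -/
theorem exists_extremal (hm : IsRepresentingMeasure A φ m) (P : Measure X) [IsFiniteMeasure P] :
    ∃ (G : Lp ℂ 2 P) (b : ℕ → C(X, ℂ)), (∀ n, b n ∈ A) ∧ (∀ n, ∫ x, b n x ∂m = 1) ∧
      Filter.Tendsto (fun n => ContinuousMap.toLp 2 P ℂ (b n)) Filter.atTop (𝓝 G) ∧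
      ∫ x, ‖G x‖ ^ 2 ∂P ≤ P.real Set.univ ∧
      ∀ a : ↥A, ∫ x, (a : C(X, ℂ)) x * ((‖G x‖ ^ 2 : ℝ) : ℂ) ∂P
        = φ a * ((∫ x, ‖G x‖ ^ 2 ∂P : ℝ) : ℂ) := by
  let J : C(X, ℂ) →ₗ[ℂ] ℂ :=
    { toFun := fun f => ∫ x, f x ∂m
      map_add' := fun f g =>
        integral_add (integrable_continuousMap m f) (integrable_continuousMap m g)
      map_smul' := fun t f => integral_const_mul t _ }
  let S : Submodule ℂ (Lp ℂ 2 P) := ((Subalgebra.toSubmodule A ⊓ J.ker).map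
    (ContinuousMap.toLp 2 P ℂ).toLinearMap).topologicalClosure
  have : CompleteSpace S := (Submodule.isClosed_topologicalClosure _).completeSpace_coe
  let e : Lp ℂ 2 P := ContinuousMap.toLp 2 P ℂ 1
  have hJ1 : J 1 = 1 := by
    have h := hm.integral_one
    change ∫ x, (1 : C(X, ℂ)) x ∂m = 1
    simp [h]
  have hproj : S.starProjection e ∈ closure ((Subalgebra.toSubmodule A ⊓ J.ker).map
    (ContinuousMap.toLp 2 P ℂ).toLinearMap : Set (Lp ℂ 2 P)) := S.starProjection_apply_mem e
  obtain ⟨y, hy, hlim⟩ := mem_closure_iff_seq_limit.1 hproj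
  choose k hk hky using hy
  let G : Lp ℂ 2 P := e - S.starProjection e
  have hmul : ∀ a ∈ A, ∀ b ∈ A, J (a * b) = J a * J b := fun a ha b hb =>
    hm.integral_mul_closure (A.le_topologicalClosure ha) (A.le_topologicalClosure hb)
  have hb : ∀ n, (1 - k n) ∈ A := fun n => A.sub_mem A.one_mem (hk n).1
  have hJb : ∀ n, J (1 - k n) = 1 := fun n => by
    rw [map_sub, hJ1, show J (k n) = 0 from (hk n).2, sub_zero]
  have hbG : Filter.Tendsto (fun n => ContinuousMap.toLp 2 P ℂ (1 - k n)) Filter.atTop (𝓝 G) := by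
    simp only [map_sub]
    refine tendsto_const_nhds.sub ?_
    convert hlim using 2 with n
    exact hky n
  -- If `a` has mean `0`, so does `a (1 - k n)`, which is therefore orthogonal to `G`. Since `1 - k
  -- n → G`, the limit of these relations is `∫ a |G|² dP = 0`.
  have hker : ∀ a ∈ A, J a = 0 → ∫ x, a x * ((‖G x‖ ^ 2 : ℝ) : ℂ) ∂P = 0 := by
    intro a ha hJa
    have hg : MemLp (fun x => a x * (starRingEnd ℂ) (G x)) 2 P :=
      (Lp.memLp G).star.mul (memLp_continuousMap ∞ a)
    have hc := ((continuous_integral_mul hg).tendsto G).comp hbG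
    have hz : ∀ n, ∫ x, (ContinuousMap.toLp 2 P ℂ (1 - k n)) x * (a x * (starRingEnd ℂ) (G x)) ∂P
        = 0 := by
      intro n
      have hmem : ContinuousMap.toLp 2 P ℂ (a * (1 - k n)) ∈ S :=
        Submodule.le_topologicalClosure _ ⟨_, ⟨A.mul_mem ha (hb n), by
          change J _ = 0
          rw [hmul a ha _ (hb n), hJa, zero_mul]⟩, rfl⟩
      have h0 := S.starProjection_inner_eq_zero e _ hmem
      rw [L2.inner_def] at h0
      rw [← h0]
      refine integral_congr_ae ?_
      filter_upwards [ContinuousMap.coeFn_toLp (p := 2) (𝕜 := ℂ) P (1 - k n),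
        ContinuousMap.coeFn_toLp (p := 2) (𝕜 := ℂ) P (a * (1 - k n))] with x h1 h2
      rw [h1, h2, RCLike.inner_apply, ContinuousMap.mul_apply]
      ring
    have hfin := tendsto_nhds_unique hc (by
      simp only [Function.comp_def, hz]; exact tendsto_const_nhds)
    rw [← hfin]
    refine integral_congr_ae (Filter.Eventually.of_forall fun x => ?_)
    change a x * ((‖G x‖ ^ 2 : ℝ) : ℂ) = G x * (a x * (starRingEnd ℂ) (G x))
    rw [mul_left_comm, Complex.mul_conj']
    push_cast
    rfl
  have hGi : Integrable (fun x => ((‖G x‖ ^ 2 : ℝ) : ℂ)) P :=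
    ((Lp.memLp G).integrable_norm_pow (by norm_num)).ofReal
  refine ⟨G, fun n => 1 - k n, hb, hJb, hbG, ?_, fun a => ?_⟩
  · rw [← norm_sq_eq_integral]
    have h1 : ‖G‖ ^ 2 ≤ ‖e‖ ^ 2 := by
      have hG : G = Sᗮ.starProjection e := by
        rw [Submodule.starProjection_orthogonal_val]
      rw [hG]
      exact pow_le_pow_left₀ (norm_nonneg _) (Sᗮ.norm_starProjection_apply_le e) 2
    refine h1.trans (le_of_eq ?_)
    rw [norm_sq_eq_integral]
    have : (fun x => ‖e x‖ ^ 2) =ᵐ[P] fun _ => (1 : ℝ) := by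
      filter_upwards [ContinuousMap.coeFn_toLp (p := 2) (𝕜 := ℂ) P (1 : C(X, ℂ))] with x hx
      simp only [e, hx]
      simp
    rw [integral_congr_ae this]
    simp
  · have h := hker ((a : C(X, ℂ)) - φ a • 1) (A.sub_mem a.2 (A.smul_mem A.one_mem _)) (by
      rw [map_sub, map_smul, hJ1, hm.integral_eq a]
      change ∫ x, (a : C(X, ℂ)) x ∂m - _ = 0
      simp)
    have hi : Integrable (fun x => (a : C(X, ℂ)) x * ((‖G x‖ ^ 2 : ℝ) : ℂ)) P :=
      hGi.bdd_mul (c := ‖(a : C(X, ℂ))‖) (a : C(X, ℂ)).continuous.measurable.aestronglyMeasurable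
        (Filter.Eventually.of_forall fun x => ContinuousMap.norm_coe_le_norm _ x)
    have h2 : (fun x => ((a : C(X, ℂ)) - φ a • 1) x * ((‖G x‖ ^ 2 : ℝ) : ℂ))
        = fun x => (a : C(X, ℂ)) x * ((‖G x‖ ^ 2 : ℝ) : ℂ) - φ a * ((‖G x‖ ^ 2 : ℝ) : ℂ) := by
      funext x
      simp [sub_mul]
    rw [h2, integral_sub hi (hGi.const_mul _), integral_const_mul, sub_eq_zero] at h
    rw [h, integral_complex_ofReal]

end Extremal

/-! ### Duality for the weak-star closure. -/

section WeakStar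

variable {X : Type*} [TopologicalSpace X] [CompactSpace X] [MeasurableSpace X] [BorelSpace X]
  {A : Subalgebra ℂ C(X, ℂ)} {φ : ↥A →ₐ[ℂ] ℂ} {m : Measure X} [IsFiniteMeasure m]

/-- Hahn–Banach for the weak-star closure `H^∞(m)`. -/
theorem mem_HInfty_of_annihilator {h : Lp ℂ ∞ m}
    (H : ∀ g : Lp ℂ 1 m, (∀ a ∈ A, ∫ x, a x * g x ∂m = 0) → ∫ x, h x * g x ∂m = 0) :
    h ∈ HInfty A m := by
  let Φ := ContinuousLinearMap.lpPairing m ∞ 1 (ContinuousLinearMap.mul ℂ ℂ)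
  have hΦ : ∀ (h : Lp ℂ ∞ m) (g : Lp ℂ 1 m), ∫ x, h x * g x ∂m = Φ h g := fun h g => by
    rw [ContinuousLinearMap.lpPairing_eq_integral]
    rfl
  have hΦa : ∀ (a : C(X, ℂ)) (g : Lp ℂ 1 m),
      Φ (ContinuousMap.toLp ∞ m ℂ a) g = ∫ x, a x * g x ∂m := fun a g => by
    rw [← hΦ]
    refine integral_congr_ae ?_
    filter_upwards [ContinuousMap.coeFn_toLp (p := ∞) (𝕜 := ℂ) m a] with x hx
    rw [hx]
  rw [HInfty, weakStarTopology, closure_induced, mem_closure_iff_nhds]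
  classical
  intro U hU
  rw [nhds_pi, Filter.mem_pi] at hU
  obtain ⟨I, hI, t, ht, hsub⟩ := hU
  have := hI.fintype
  let r : Lp ℂ ∞ m →ₗ[ℂ] (I → ℂ) := LinearMap.pi fun i => Φ.flip i
  let V : Submodule ℂ (I → ℂ) := ((Subalgebra.toSubmodule A).map
    (ContinuousMap.toLp ∞ m ℂ).toLinearMap).map r
  -- A basic neighbourhood tests only finitely many functions of `L¹(m)`. In that finite-dimensional
  -- quotient, a functional vanishing on `A` but not at `h` would be a combination `g` contradicting
  -- `H`; so some `a` agrees with `h` on all the tests exactly.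
  have hmem : r h ∈ V := by
    by_contra hnot
    obtain ⟨ℓ, hℓ, hV⟩ := Submodule.exists_le_ker_of_notMem hnot
    let g : Lp ℂ 1 m := ∑ i : I, ℓ (Pi.single i 1) • (i : Lp ℂ 1 m)
    have hg : ∀ k : Lp ℂ ∞ m, Φ k g = ℓ (r k) := fun k => by
      rw [LinearMap.pi_apply_eq_sum_univ ℓ (r k)]
      simp only [g, map_sum, map_smul]
      refine Finset.sum_congr rfl fun i _ => ?_
      rw [smul_eq_mul, smul_eq_mul, mul_comm]
      congr 2
      ext j
      simp [Pi.single_apply, eq_comm]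
    refine hℓ ?_
    rw [← hg, ← hΦ]
    refine H g fun a ha => ?_
    rw [← hΦa, hg]
    exact hV ⟨_, ⟨a, ha, rfl⟩, rfl⟩
  obtain ⟨_, ⟨a, ha, rfl⟩, hra⟩ := hmem
  refine ⟨_, hsub ?_, ⟨_, ⟨a, ha, rfl⟩, rfl⟩⟩
  intro i hi
  have h1 := congrFun hra ⟨i, hi⟩
  have h2 : ∫ x, (ContinuousMap.toLp ∞ m ℂ a) x * i x ∂m = ∫ x, h x * i x ∂m := by
    rw [hΦ, hΦ]; exact h1
  change ∫ x, (ContinuousMap.toLp ∞ m ℂ a) x * i x ∂m ∈ t i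
  rw [h2]
  exact mem_of_mem_nhds (ht i)

end WeakStar

/-! ### Multiplication on `H²(m)` and multipliers adapted to a weight. -/

section Multiplier

variable {X : Type*} [TopologicalSpace X] [CompactSpace X] [MeasurableSpace X] [BorelSpace X]
  {A : Subalgebra ℂ C(X, ℂ)} {φ : ↥A →ₐ[ℂ] ℂ} {m : Measure X} [IsFiniteMeasure m]

/-- Multiplication by a bounded function, as an operator on `L²(m)`. -/
def mulLp (h : Lp ℂ ∞ m) : Lp ℂ 2 m →L[ℂ] Lp ℂ 2 m :=
  (ContinuousLinearMap.mul ℂ ℂ).holderL m ∞ 2 2 h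

lemma coeFn_mulLp (h : Lp ℂ ∞ m) (f : Lp ℂ 2 m) : mulLp h f =ᵐ[m] fun x => h x * f x :=
  ContinuousLinearMap.coeFn_holder _ h f

lemma isClosed_H2 : IsClosed (H2 A m : Set (Lp ℂ 2 m)) :=
  Submodule.isClosed_topologicalClosure _

lemma mulLp_toLp_mem_H2 {a : C(X, ℂ)} (ha : a ∈ A) {f : Lp ℂ 2 m} (hf : f ∈ H2 A m) :
    mulLp (ContinuousMap.toLp ∞ m ℂ a) f ∈ H2 A m := by
  refine H2_induction (P := fun f => mulLp (ContinuousMap.toLp ∞ m ℂ a) f ∈ H2 A m)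
    (isClosed_H2.preimage (mulLp _).continuous) (fun b hb => ?_) hf
  convert toLp_mem_H2 (m := m) (A.mul_mem ha hb) using 1
  refine Lp.ext ?_
  filter_upwards [coeFn_mulLp (ContinuousMap.toLp ∞ m ℂ a) (ContinuousMap.toLp 2 m ℂ b),
    ContinuousMap.coeFn_toLp (p := ∞) (𝕜 := ℂ) m a, ContinuousMap.coeFn_toLp (p := 2) (𝕜 := ℂ) m b,
    ContinuousMap.coeFn_toLp (p := 2) (𝕜 := ℂ) m (a * b)] with x h1 h2 h3 h4
  rw [h1, h2, h3, h4, ContinuousMap.mul_apply]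

/-- `H²(m)` is invariant under multiplication by the bounded functions in `H²(m)`. -/
lemma mulLp_mem_H2 {h : Lp ℂ ∞ m} {k : Lp ℂ 2 m} (hk : k ∈ H2 A m) (hhk : h =ᵐ[m] k)
    {f : Lp ℂ 2 m} (hf : f ∈ H2 A m) : mulLp h f ∈ H2 A m := by
  refine H2_induction (P := fun f => mulLp h f ∈ H2 A m)
    (isClosed_H2.preimage (mulLp _).continuous) (fun a ha => ?_) hf
  convert mulLp_toLp_mem_H2 ha hk using 1
  refine Lp.ext ?_
  filter_upwards [coeFn_mulLp h (ContinuousMap.toLp 2 m ℂ a), hhk,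
    coeFn_mulLp (ContinuousMap.toLp ∞ m ℂ a) k,
    ContinuousMap.coeFn_toLp (p := ∞) (𝕜 := ℂ) m a,
    ContinuousMap.coeFn_toLp (p := 2) (𝕜 := ℂ) m a] with x h1 h2 h3 h4 h5
  rw [h1, h3, h4, h5, h2, mul_comm]

/-- For an integrable weight `w ≥ 1` there is `G` in the closure of `A` in `L²(w m)` with mean `1`
such that `|G|² w` is bounded. -/
theorem exists_multiplier [T2Space X] (hm : IsRepresentingMeasure A φ m) {C : NNReal}
    (hC : ∀ (ν : Measure X) [IsFiniteMeasure ν], IsRepresentingMeasure A φ ν → ν ≤ C • m)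
    {w : X → NNReal} (hw : Measurable w) (hw1 : ∀ x, 1 ≤ w x)
    (hwi : Integrable (fun x => (w x : ℝ)) m) :
    ∃ (G : Lp ℂ 2 (m.withDensity fun x => (w x : ℝ≥0∞))) (b : ℕ → C(X, ℂ)),
      (∀ n, b n ∈ A) ∧
      Filter.Tendsto (fun n => eLpNorm (fun x => b n x - G x) 2
        (m.withDensity fun x => (w x : ℝ≥0∞))) Filter.atTop (𝓝 0) ∧
      ∫ x, G x ∂m = 1 ∧ MemLp G 2 m ∧
      ∫ x, ‖G x‖ ^ 2 ∂m ≤ ∫ x, (w x : ℝ) ∂m ∧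
      ∀ᵐ x ∂m, ‖G x‖ ^ 2 * w x ≤ C * ∫ x, (w x : ℝ) ∂m := by
  have := hm.regular
  have hwe : Measurable fun x => (w x : ℝ≥0∞) := hw.coe_nnreal_ennreal
  have hwl : ∫⁻ x, (w x : ℝ≥0∞) ∂m ≠ ∞ := by
    have := hwi.2
    simp only [HasFiniteIntegral, ← ofReal_norm, Real.norm_eq_abs, NNReal.abs_eq,
      ENNReal.ofReal_coe_nnreal] at this
    exact this.ne
  set P := m.withDensity fun x => (w x : ℝ≥0∞) with hP
  have : IsFiniteMeasure P := isFiniteMeasure_withDensity hwl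
  -- This is where `w ≥ 1` enters: convergence in `L²(P)` implies convergence in `L²(m)`, so mean
  -- `1` survives in the limit.
  have hmP : m ≤ P := by
    conv_lhs => rw [← withDensity_one (μ := m)]
    exact withDensity_mono (Filter.Eventually.of_forall fun x => by
      simpa using hw1 x)
  have hPuniv : P.real Set.univ = ∫ x, (w x : ℝ) ∂m := by
    have h := integral_withDensity_eq_integral_smul (μ := m) hw (fun _ => (1 : ℝ))
    rw [← hP, integral_const, smul_eq_mul, mul_one] at h
    rw [h]
    simp [NNReal.smul_def]
  obtain ⟨G, b, hbA, hb1, hbG, hG1, hGrep⟩ := exists_extremal hm P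
  have htend : Filter.Tendsto (fun n => eLpNorm (fun x => b n x - G x) 2 P) Filter.atTop (𝓝 0) := by
    rw [Lp.tendsto_Lp_iff_tendsto_eLpNorm'] at hbG
    refine hbG.congr fun n => eLpNorm_congr_ae ?_
    filter_upwards [ContinuousMap.coeFn_toLp (p := 2) (𝕜 := ℂ) P (b n)] with x hx
    simp only [Pi.sub_apply, hx]
  have hGm : MemLp G 2 m := (Lp.memLp G).mono_measure hmP
  have hGint : ∫ x, G x ∂m = 1 := by
    have h1 : Filter.Tendsto (fun n => eLpNorm (⇑(b n) - ⇑G) 1 m) Filter.atTop (𝓝 0) := by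
      have h2 : Filter.Tendsto (fun n => eLpNorm (fun x => b n x - G x) 2 P *
        m Set.univ ^ (1 / (1 : ℝ≥0∞).toReal - 1 / (2 : ℝ≥0∞).toReal)) Filter.atTop (𝓝 0) := by
        have := ENNReal.Tendsto.mul_const (b := m Set.univ ^ (1 / (1 : ℝ≥0∞).toReal
          - 1 / (2 : ℝ≥0∞).toReal)) htend (Or.inr (by
            refine ENNReal.rpow_ne_top_of_nonneg (by norm_num) (measure_ne_top _ _)))
        simpa using this
      refine tendsto_of_tendsto_of_tendsto_of_le_of_le tendsto_const_nhds h2 (fun _ => zero_le)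
        fun n => ?_
      refine (eLpNorm_le_eLpNorm_mul_rpow_measure_univ one_le_two
        ((b n).continuous.measurable.aestronglyMeasurable.sub hGm.1)).trans ?_
      gcongr
      exact eLpNorm_mono_measure _ hmP
    have h3 := tendsto_integral_of_L1' (f := G) hGm.1
      (Filter.Eventually.of_forall fun n => integrable_continuousMap m (b n)) h1
    simp only [hb1] at h3
    exact tendsto_nhds_unique h3 tendsto_const_nhds
  have hGP : Integrable (fun x => ‖G x‖ ^ 2) P := (Lp.memLp G).integrable_norm_pow (by norm_num)
  set D := ∫ x, ‖G x‖ ^ 2 ∂P with hD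
  have hmD : ∫ x, ‖G x‖ ^ 2 ∂m ≤ D :=
    integral_mono_measure hmP (Filter.Eventually.of_forall fun x => by positivity) hGP
  have hDpos : 0 < D := by
    refine (integral_nonneg fun x => by positivity).lt_of_ne fun h0 => ?_
    have h1 := (integral_eq_zero_iff_of_nonneg (fun x => by positivity) hGP).1 h0.symm
    have h2 : ∀ᵐ x ∂m, G x = 0 := by
      filter_upwards [(Measure.absolutelyContinuous_of_le hmP).ae_le h1] with x hx
      simpa using hx
    rw [integral_eq_zero_of_ae h2] at hGint
    exact zero_ne_one hGint
  have hGmeas : Measurable G := (Lp.stronglyMeasurable G).measurable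
  let ρ : X → NNReal := fun x => ‖G x‖₊ ^ 2 / D.toNNReal
  have hρ : Measurable ρ := by fun_prop
  have hρcoe : ∀ x, (ρ x : ℝ) = ‖G x‖ ^ 2 / D := fun x => by
    simp [ρ, Real.coe_toNNReal _ hDpos.le]
  -- The normalised extremal measure is representing, so its density `|G|² w / D` with respect to
  -- `m` is at most `C`, and `D ≤ ∫ w`.
  let ν := P.withDensity fun x => (ρ x : ℝ≥0∞)
  have hνm : ν = m.withDensity fun x => ((w x * ρ x : NNReal) : ℝ≥0∞) := by
    simp only [ν, hP]
    rw [← withDensity_mul _ hwe hρ.coe_nnreal_ennreal]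
    simp only [ENNReal.coe_mul]
    rfl
  have hρfin : ∫⁻ x, (ρ x : ℝ≥0∞) ∂P ≠ ∞ := by
    have h := (hGP.div_const D).2
    have e : ∀ x, ‖‖G x‖ ^ 2 / D‖ₑ = (ρ x : ℝ≥0∞) := fun x => by
      rw [← hρcoe, ← ofReal_norm, Real.norm_eq_abs, NNReal.abs_eq,
        ENNReal.ofReal_coe_nnreal]
    simp only [HasFiniteIntegral, e] at h
    exact h.ne
  have : IsFiniteMeasure ν := isFiniteMeasure_withDensity hρfin
  have hνrep : IsRepresentingMeasure A φ ν := by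
    have hPreg : P.Regular := regular_withDensity hwl
    refine ⟨regular_withDensity hρfin, fun a => ?_⟩
    rw [integral_withDensity_eq_integral_smul hρ]
    have e : ∀ x, ρ x • (a : C(X, ℂ)) x
        = ((a : C(X, ℂ)) x * ((‖G x‖ ^ 2 : ℝ) : ℂ)) * ((D⁻¹ : ℝ) : ℂ) := fun x => by
      rw [NNReal.smul_def, hρcoe, Complex.real_smul]
      push_cast
      ring
    simp only [e]
    rw [integral_mul_const, hGrep a, mul_assoc, ← Complex.ofReal_mul, mul_inv_cancel₀ hDpos.ne']
    simp
  refine ⟨G, b, hbA, htend, hGint, hGm, hmD.trans (hG1.trans hPuniv.le), ?_⟩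
  have hle := hC ν hνrep
  have hae : (fun x => ((w x * ρ x : NNReal) : ℝ≥0∞)) ≤ᵐ[m] fun _ => (C : ℝ≥0∞) := by
    refine ae_le_of_forall_setLIntegral_le_of_sigmaFinite (hw.mul hρ).coe_nnreal_ennreal
      fun s hs _ => ?_
    rw [← withDensity_apply _ hs, ← hνm, setLIntegral_const]
    exact hle s
  filter_upwards [hae] with x hx
  have h1 : (w x : ℝ) * ρ x ≤ C := by exact_mod_cast hx
  rw [hρcoe, ← mul_div_assoc, div_le_iff₀ hDpos] at h1
  rw [mul_comm]
  exact h1.trans (mul_le_mul_of_nonneg_left (hG1.trans hPuniv.le) C.2)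

end Multiplier

/-! ### Bounded functions of `H²(m)` belong to `H^∞(m)`. -/

section BoundedFunctions

variable {X : Type*} [TopologicalSpace X] [CompactSpace X] [MeasurableSpace X] [BorelSpace X]
  {A : Subalgebra ℂ C(X, ℂ)} {φ : ↥A →ₐ[ℂ] ℂ} {m : Measure X} [IsFiniteMeasure m]

lemma eLpNorm_mul_le_withDensity {w : X → NNReal} (hw : Measurable w) {u f : X → ℂ}
    (hfw : ∀ᵐ x ∂m, ‖f x‖ ^ 2 ≤ w x) :
    eLpNorm (fun x => u x * f x) 2 m ≤ eLpNorm u 2 (m.withDensity fun x => (w x : ℝ≥0∞)) := by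
  rw [eLpNorm_eq_lintegral_rpow_enorm_toReal two_ne_zero ENNReal.ofNat_ne_top,
    eLpNorm_eq_lintegral_rpow_enorm_toReal two_ne_zero ENNReal.ofNat_ne_top,
    lintegral_withDensity_eq_lintegral_mul_non_measurable _ hw.coe_nnreal_ennreal
      (Filter.Eventually.of_forall fun x => ENNReal.coe_lt_top)]
  gcongr ?_ ^ _
  refine lintegral_mono_ae ?_
  filter_upwards [hfw] with x hx
  have h : ‖f x‖ₑ ^ (2 : ℝ) ≤ w x := by
    have h2 : ‖f x‖₊ ^ 2 ≤ w x := by exact_mod_cast hx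
    rw [ENNReal.rpow_ofNat]
    change (‖f x‖₊ : ℝ≥0∞) ^ 2 ≤ w x
    exact_mod_cast h2
  simp only [Pi.mul_apply, ENNReal.toReal_ofNat]
  rw [enorm_mul, ENNReal.mul_rpow_of_nonneg _ _ zero_le_two, mul_comm]
  gcongr

/-- Multiplying `f ∈ H²(m)` by a limit of elements of `A` in `L²(w m)`, where `|f|² ≤ w`. -/
lemma mul_mem_H2_of_tendsto {w : X → NNReal} (hw : Measurable w)
    {G : X → ℂ} {b : ℕ → C(X, ℂ)} (hb : ∀ n, b n ∈ A)
    (hbG : Filter.Tendsto (fun n => eLpNorm (fun x => b n x - G x) 2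
        (m.withDensity fun x => (w x : ℝ≥0∞))) Filter.atTop (𝓝 0))
    {f : Lp ℂ 2 m} (hf : f ∈ H2 A m) (hfw : ∀ᵐ x ∂m, ‖f x‖ ^ 2 ≤ w x)
    {k : Lp ℂ 2 m} (hk : k =ᵐ[m] fun x => G x * f x) : k ∈ H2 A m := by
  refine isClosed_H2.mem_of_tendsto (f := fun n => mulLp (ContinuousMap.toLp ∞ m ℂ (b n)) f)
    (b := Filter.atTop) ?_ (Filter.Eventually.of_forall fun n => mulLp_toLp_mem_H2 (hb n) hf)
  rw [Lp.tendsto_Lp_iff_tendsto_eLpNorm']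
  refine tendsto_of_tendsto_of_tendsto_of_le_of_le tendsto_const_nhds hbG (fun _ => zero_le)
    fun n => ?_
  refine le_trans (le_of_eq (eLpNorm_congr_ae ?_)) (eLpNorm_mul_le_withDensity hw hfw)
  filter_upwards [coeFn_mulLp (ContinuousMap.toLp ∞ m ℂ (b n)) f, hk,
    ContinuousMap.coeFn_toLp (p := ∞) (𝕜 := ℂ) m (b n)] with x h1 h2 h3
  rw [Pi.sub_apply, h1, h2, h3, sub_mul]

/-- If `g ∈ L¹(m)` annihilates `A` and `G` is a limit of elements of `A` in `L²(w m)`, where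
`w` dominates `|g|`, then `G² g` annihilates `A`. -/
lemma integral_mul_sq_eq_zero {w : X → NNReal} (hw : Measurable w) (hw1 : ∀ x, 1 ≤ w x)
    {P : Measure X} (hP : P = m.withDensity fun x => (w x : ℝ≥0∞)) [IsFiniteMeasure P]
    {G : Lp ℂ 2 P} {b : ℕ → C(X, ℂ)} (hb : ∀ n, b n ∈ A)
    (hbG : Filter.Tendsto (fun n => eLpNorm (fun x => b n x - G x) 2 P) Filter.atTop (𝓝 0))
    {g : X → ℂ} (hg : StronglyMeasurable g) {M : ℝ} (hgw : ∀ x, ‖g x‖ ≤ M * w x)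
    (hann : ∀ a ∈ A, ∫ x, a x * g x ∂m = 0) {a : C(X, ℂ)} (ha : a ∈ A) :
    ∫ x, a x * (G x ^ 2 * g x) ∂m = 0 := by
  have hw0 : ∀ x, ((w x : ℝ) : ℂ) ≠ 0 := fun x => by
    have := (zero_lt_one.trans_le (hw1 x)).ne'
    exact_mod_cast this
  have hwm : Measurable fun x => ((w x : ℝ) : ℂ) := by fun_prop
  -- Pairing with `g` over `m` equals pairing with the bounded function `g / w` over `P`, which is
  -- compatible with `L²(P)` limits.
  have hγ : MemLp (fun x => g x / ((w x : ℝ) : ℂ)) ∞ P := by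
    refine memLp_top_of_bound (hg.measurable.div hwm).aestronglyMeasurable M
      (Filter.Eventually.of_forall fun x => ?_)
    have h1 : (0 : ℝ) < w x := zero_lt_one.trans_le (by exact_mod_cast hw1 x)
    rw [norm_div, Complex.norm_real, Real.norm_of_nonneg h1.le, div_le_iff₀ h1]
    exact hgw x
  have htrans : ∀ u : X → ℂ, ∫ x, u x * (g x / ((w x : ℝ) : ℂ)) ∂P = ∫ x, u x * g x ∂m := by
    intro u
    rw [hP, integral_withDensity_eq_integral_smul hw]
    refine integral_congr_ae (Filter.Eventually.of_forall fun x => ?_)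
    change w x • (u x * (g x / ((w x : ℝ) : ℂ))) = u x * g x
    rw [NNReal.smul_def, Complex.real_smul]
    field_simp [hw0 x]
  have hLp : Filter.Tendsto (fun n => ContinuousMap.toLp 2 P ℂ (b n)) Filter.atTop (𝓝 G) := by
    rw [Lp.tendsto_Lp_iff_tendsto_eLpNorm']
    refine hbG.congr fun n => eLpNorm_congr_ae ?_
    filter_upwards [ContinuousMap.coeFn_toLp (p := 2) (𝕜 := ℂ) P (b n)] with x hx
    simp only [Pi.sub_apply, hx]
  -- The two factors `b k` and `b n` are replaced by `G` one at a time: `v = b n · a` is used before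
  -- `v = a · G`.
  have hpass : ∀ v : X → ℂ, MemLp v 2 P →
      (∀ n, ∫ x, b n x * v x * (g x / ((w x : ℝ) : ℂ)) ∂P = 0) →
      ∫ x, G x * v x * (g x / ((w x : ℝ) : ℂ)) ∂P = 0 := by
    intro v hv h0
    have hvg : MemLp (fun x => v x * (g x / ((w x : ℝ) : ℂ))) 2 P := hγ.mul hv
    have hc := ((continuous_integral_mul hvg).tendsto G).comp hLp
    have hz : ∀ n, ∫ x, (ContinuousMap.toLp 2 P ℂ (b n)) x * (v x * (g x / ((w x : ℝ) : ℂ))) ∂P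
        = 0 := by
      intro n
      rw [← h0 n]
      refine integral_congr_ae ?_
      filter_upwards [ContinuousMap.coeFn_toLp (p := 2) (𝕜 := ℂ) P (b n)] with x hx
      rw [hx, mul_assoc]
    simp only [Function.comp_def, hz] at hc
    rw [← tendsto_nhds_unique hc tendsto_const_nhds]
    simp only [mul_assoc]
  have hGa : MemLp (fun x => a x * G x) 2 P := (Lp.memLp G).mul (memLp_continuousMap ∞ a)
  have h1 : ∀ n, ∫ x, b n x * (a x * G x) * (g x / ((w x : ℝ) : ℂ)) ∂P = 0 := by
    intro n
    have := hpass (fun x => (b n * a) x) (memLp_continuousMap 2 _) fun k => by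
      rw [htrans]
      exact hann (b k * (b n * a)) (A.mul_mem (hb k) (A.mul_mem (hb n) ha))
    rw [← this]
    refine integral_congr_ae (Filter.Eventually.of_forall fun x => ?_)
    change b n x * (a x * G x) * _ = G x * (b n x * a x) * _
    ring
  have h2 := hpass _ hGa h1
  rw [htrans] at h2
  rw [← h2]
  refine integral_congr_ae (Filter.Eventually.of_forall fun x => ?_)
  change a x * (G x ^ 2 * g x) = G x * (a x * G x) * g x
  ring

/-- If the functions `Gₙ` have mean `1` with respect to the probability measure `m` and
`∫ |Gₙ|² dm → 1`, then a subsequence converges to `1` almost everywhere. -/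
lemma exists_subseq_tendsto_one (hm1 : m.real Set.univ = 1) {G : ℕ → X → ℂ}
    (hG : ∀ n, MemLp (G n) 2 m) (hG1 : ∀ n, ∫ x, G n x ∂m = 1) {δ : ℕ → ℝ}
    (hδ : Filter.Tendsto δ Filter.atTop (𝓝 0)) (hle : ∀ n, ∫ x, ‖G n x‖ ^ 2 ∂m ≤ 1 + δ n) :
    ∃ ns : ℕ → ℕ, StrictMono ns ∧
      ∀ᵐ x ∂m, Filter.Tendsto (fun i => G (ns i) x) Filter.atTop (𝓝 1) := by
  have hsub : ∀ n, MemLp (fun x => G n x - 1) 2 m := fun n => (hG n).sub (memLp_const 1)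
  -- Expanding the square, the mean `1` contributes `-2 + 1`, leaving at most `δ n`.
  have hint : ∀ n, ∫ x, ‖G n x - 1‖ ^ 2 ∂m ≤ δ n := by
    intro n
    have e : ∀ x, ‖G n x - 1‖ ^ 2 = ‖G n x‖ ^ 2 - 2 * (G n x).re + 1 := by
      intro x
      rw [← Complex.normSq_eq_norm_sq, ← Complex.normSq_eq_norm_sq,
        Complex.normSq_apply, Complex.normSq_apply]
      simp
      ring
    have hi1 := (hG n).integrable_norm_pow (p := 2) (by norm_num)
    have hi2 := ((hG n).integrable one_le_two)
    have hre : ∫ x, (G n x).re ∂m = 1 := by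
      have := integral_re (𝕜 := ℂ) hi2
      simp only [RCLike.re_to_complex] at this
      rw [this, hG1 n, Complex.one_re]
    simp only [e]
    have hi3 : Integrable (fun x => 2 * (G n x).re) m := hi2.re.const_mul 2
    have hi4 : Integrable (fun x => ‖G n x‖ ^ 2 - 2 * (G n x).re) m := hi1.sub hi3
    rw [integral_add hi4 (integrable_const _), integral_sub hi1 hi3, integral_const_mul,
      integral_const, hm1, hre]
    simp only [smul_eq_mul, mul_one]
    linarith [hle n]
  have hlim : Filter.Tendsto (fun n => eLpNorm (fun x => G n x - 1) 2 m)
      Filter.atTop (𝓝 0) := by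
    have h1 : Filter.Tendsto (fun n => ENNReal.ofReal (Real.sqrt (δ n))) Filter.atTop (𝓝 0) := by
      have := (ENNReal.continuous_ofReal.comp Real.continuous_sqrt).tendsto 0 |>.comp hδ
      simpa [Function.comp_def] using this
    refine tendsto_of_tendsto_of_tendsto_of_le_of_le tendsto_const_nhds h1 (fun _ => zero_le)
      fun n => ?_
    rw [(hsub n).eLpNorm_eq_integral_rpow_norm two_ne_zero ENNReal.ofNat_ne_top]
    refine ENNReal.ofReal_le_ofReal ?_
    rw [ENNReal.toReal_ofNat, Real.sqrt_eq_rpow, ← one_div]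
    simp only [Real.rpow_ofNat]
    exact Real.rpow_le_rpow (integral_nonneg fun x => by positivity) (hint n) (by norm_num)
  obtain ⟨ns, hns, h⟩ := (tendstoInMeasure_of_tendsto_eLpNorm two_ne_zero (fun n => (hG n).1)
    aestronglyMeasurable_const hlim).exists_seq_tendsto_ae
  exact ⟨ns, hns, h⟩

/-- Bounded functions in `H²(m)` belong to `H^∞(m)`, for a core measure `m`. -/
theorem mem_HInfty_of_mem_H2 [T2Space X] (hm : IsCoreMeasure A φ m) {h : Lp ℂ ∞ m}
    {k : Lp ℂ 2 m} (hk : k ∈ H2 A m) (hhk : h =ᵐ[m] k) : h ∈ HInfty A m := by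
  refine mem_HInfty_of_annihilator fun g hann => ?_
  obtain ⟨C, hC⟩ := hm.exists_forall_le_smul
  have hm1 := hm.1.integral_one
  have hgm : StronglyMeasurable g := Lp.stronglyMeasurable g
  have hgi : Integrable g m := memLp_one_iff_integrable.1 (Lp.memLp g)
  -- The weight dominates `|g| / (n + 1)`, which makes `G n ^ 2 * g` bounded, and its integral tends
  -- to `1`, which forces `G n → 1` along a subsequence.
  let w : ℕ → X → NNReal := fun n x => 1 + ‖g x‖₊ / (n + 1)
  have hw : ∀ n, Measurable (w n) := fun n => by
    have := hgm.measurable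
    fun_prop
  have hw1 : ∀ n x, 1 ≤ w n x := fun n x => le_self_add
  have hwc : ∀ n x, (w n x : ℝ) = 1 + ‖g x‖ / (n + 1) := fun n x => by simp [w]
  have hwi : ∀ n, Integrable (fun x => (w n x : ℝ)) m := fun n => by
    simp only [hwc]
    exact (integrable_const _).add (hgi.norm.div_const _)
  set I := ∫ x, ‖g x‖ ∂m
  have hI : 0 ≤ I := integral_nonneg fun x => norm_nonneg _
  have hwI : ∀ n, ∫ x, (w n x : ℝ) ∂m = 1 + I / (n + 1) := fun n => by
    simp only [hwc]
    rw [integral_add (integrable_const _) (hgi.norm.div_const _), integral_const, hm1,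
      integral_div]
    simp [I]
  choose G b hbA hbG hG1 hG2 hGw hGb using fun n =>
    exists_multiplier hm.1 hC (hw n) (hw1 n) (hwi n)
  have hwI2 : ∀ n : ℕ, 1 + I / ((n : ℝ) + 1) ≤ 1 + I := fun n => by
    have : I / ((n : ℝ) + 1) ≤ I := div_le_self hI (by linarith [n.cast_nonneg (α := ℝ)])
    linarith
  have hGbdg : ∀ n, ∀ᵐ x ∂m, ‖G n x‖ ^ 2 ≤ C * (1 + I) := fun n => by
    filter_upwards [hGb n] with x hx
    rw [hwI] at hx
    have h1 : ‖G n x‖ ^ 2 * 1 ≤ ‖G n x‖ ^ 2 * w n x :=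
      mul_le_mul_of_nonneg_left (by exact_mod_cast hw1 n x) (by positivity)
    have h2 := mul_le_mul_of_nonneg_left (hwI2 n) C.2
    rw [mul_one] at h1
    exact h1.trans (hx.trans h2)
  have hzero : ∀ n, ∫ x, h x * (G n x ^ 2 * g x) ∂m = 0 := by
    intro n
    have hPfin : IsFiniteMeasure (m.withDensity fun x => (w n x : ℝ≥0∞)) := by
      refine isFiniteMeasure_withDensity ?_
      have := (hwi n).2
      simp only [HasFiniteIntegral, ← ofReal_norm, Real.norm_eq_abs, NNReal.abs_eq,
        ENNReal.ofReal_coe_nnreal] at this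
      exact this.ne
    have hgw : ∀ x, ‖g x‖ ≤ ((n : ℝ) + 1) * w n x := fun x => by
      rw [hwc, mul_add, mul_div_cancel₀ _ (by positivity)]
      have : (0 : ℝ) ≤ (n + 1) * 1 := by positivity
      linarith
    have hbd : MemLp (fun x => G n x ^ 2 * g x) 2 m := by
      refine MemLp.mono_exponent (q := ∞) (memLp_top_of_bound
        (((hG2 n).1.pow 2).mul hgm.aestronglyMeasurable) (((n : ℝ) + 1) * (C * (1 + I))) ?_) le_top
      filter_upwards [hGb n] with x hx
      rw [hwI] at hx
      rw [norm_mul, norm_pow]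
      calc ‖G n x‖ ^ 2 * ‖g x‖ ≤ ‖G n x‖ ^ 2 * (((n : ℝ) + 1) * w n x) := by
            gcongr; exact hgw x
        _ = ((n : ℝ) + 1) * (‖G n x‖ ^ 2 * w n x) := by ring
        _ ≤ ((n : ℝ) + 1) * (C * (1 + I)) := by
            exact mul_le_mul_of_nonneg_left
              (hx.trans (mul_le_mul_of_nonneg_left (hwI2 n) C.2)) (by positivity)
    -- As `G n ^ 2 * g` is in `L²(m)`, its annihilation of `A` extends to all of `H²(m)`, which is
    -- not known for `g` itself.
    have hH : ∫ x, k x * (G n x ^ 2 * g x) ∂m = 0 := by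
      refine H2_induction (P := fun k => ∫ x, k x * (G n x ^ 2 * g x) ∂m = 0)
        (isClosed_eq (continuous_integral_mul hbd) continuous_const) (fun a ha => ?_) hk
      rw [← integral_mul_sq_eq_zero (hw n) (hw1 n) rfl (hbA n) (hbG n) hgm hgw hann ha]
      refine integral_congr_ae ?_
      filter_upwards [ContinuousMap.coeFn_toLp (p := 2) (𝕜 := ℂ) m a] with x hx
      rw [hx]
    rw [← hH]
    refine integral_congr_ae ?_
    filter_upwards [hhk] with x hx
    rw [hx]
  obtain ⟨ns, hns, hae⟩ := exists_subseq_tendsto_one hm1 hG2 hG1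
    (δ := fun n : ℕ => I / ((n : ℝ) + 1)) (tendsto_const_nhds.div_atTop
        (Filter.tendsto_atTop_add_const_right _ _ tendsto_natCast_atTop_atTop))
    (fun n => (hGw n).trans (hwI n).le)
  have hhm : AEStronglyMeasurable h m := (Lp.memLp h).1
  obtain ⟨Mh, hMh⟩ : ∃ M : ℝ, ∀ᵐ x ∂m, ‖h x‖ ≤ M := by
    refine ⟨(eLpNormEssSup h m).toReal, ?_⟩
    have hfin : eLpNormEssSup h m ≠ ∞ := by
      have := (Lp.memLp h).2
      rw [eLpNorm_exponent_top] at this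
      exact this.ne
    filter_upwards [ae_le_eLpNormEssSup (f := h) (μ := m)] with x hx
    have := ENNReal.toReal_mono hfin hx
    simpa using this
  -- The bound `|G n|² ≤ C (1 + I)`, uniform in `n`, provides the dominating multiple of `|g|`.
  have hlim := tendsto_integral_of_dominated_convergence (μ := m)
    (F := fun i x => h x * (G (ns i) x ^ 2 * g x)) (f := fun x => h x * (1 ^ 2 * g x))
    (fun x => |Mh| * (C * (1 + I) * ‖g x‖))
    (fun i => hhm.mul (((hG2 (ns i)).1.pow 2).mul hgm.aestronglyMeasurable))
    ((hgi.norm.const_mul _).const_mul _)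
    (fun i => by
      filter_upwards [hMh, hGbdg (ns i)] with x h1 h2
      rw [norm_mul, norm_mul, norm_pow]
      gcongr
      exact h1.trans (le_abs_self _))
    (by
      filter_upwards [hae] with x hx
      exact ((hx.pow 2).mul_const _).const_mul _)
  simp only [hzero, one_pow, one_mul] at hlim
  exact tendsto_nhds_unique hlim tendsto_const_nhds

end BoundedFunctions

/-! ### Common denominators, commutation with `T`, and closability. -/

section Quotients

variable {X : Type*} [TopologicalSpace X] [CompactSpace X] [MeasurableSpace X] [BorelSpace X]
  {A : Subalgebra ℂ C(X, ℂ)} {φ : ↥A →ₐ[ℂ] ℂ} {m : Measure X} [IsFiniteMeasure m]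

/-- Two functions of `H²(m)` have a common denominator: there is `G ∈ H²(m)` with mean `1` that
multiplies both into bounded functions in `H²(m)`. -/
theorem exists_common_denominator [T2Space X] (hm : IsCoreMeasure A φ m) {f g : Lp ℂ 2 m}
    (hf : f ∈ H2 A m) (hg : g ∈ H2 A m) :
    ∃ G ∈ H2 A m, ∫ x, G x ∂m = 1 ∧ ∃ F₁ F₂ : Lp ℂ ∞ m,
      (∃ K ∈ H2 A m, F₁ =ᵐ[m] K) ∧ (∃ K ∈ H2 A m, F₂ =ᵐ[m] K) ∧
      (F₁ =ᵐ[m] fun x => G x * f x) ∧ F₂ =ᵐ[m] fun x => G x * g x := by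
  obtain ⟨C, hC⟩ := hm.exists_forall_le_smul
  -- Both `|G f|²` and `|G g|²` are at most `|G|² w`, which is bounded; integrability of `w` is
  -- exactly that `f` and `g` are in `L²(m)`.
  let w : X → NNReal := fun x => 1 + ‖f x‖₊ ^ 2 + ‖g x‖₊ ^ 2
  have hw : Measurable w := by
    have := (Lp.stronglyMeasurable f).measurable
    have := (Lp.stronglyMeasurable g).measurable
    fun_prop
  have hw1 : ∀ x, 1 ≤ w x := fun x => le_self_add.trans le_self_add
  have hwc : ∀ x, (w x : ℝ) = 1 + ‖f x‖ ^ 2 + ‖g x‖ ^ 2 := fun x => by simp [w]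
  have hwi : Integrable (fun x => (w x : ℝ)) m := by
    simp only [hwc]
    exact ((integrable_const _).add ((Lp.memLp f).integrable_norm_pow (by norm_num))).add
      ((Lp.memLp g).integrable_norm_pow (by norm_num))
  obtain ⟨G, b, hbA, hbG, hG1, hG2, -, hGb⟩ := exists_multiplier hm.1 hC hw hw1 hwi
  set I := ∫ x, (w x : ℝ) ∂m
  have hone : ∀ k : Lp ℂ 2 m, k ∈ H2 A m → (∀ x, ‖k x‖ ^ 2 ≤ w x) →
      ∃ (F : Lp ℂ ∞ m), (∃ K ∈ H2 A m, F =ᵐ[m] K) ∧ F =ᵐ[m] fun x => G x * k x := by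
    intro k hk hkw
    have hF : MemLp (fun x => G x * k x) ∞ m := by
      refine memLp_top_of_bound (hG2.1.mul (Lp.memLp k).1) (Real.sqrt (C * I)) ?_
      filter_upwards [hGb] with x hx
      refine Real.le_sqrt_of_sq_le ?_
      rw [norm_mul, mul_pow]
      exact (mul_le_mul_of_nonneg_left (hkw x) (by positivity)).trans hx
    have hF2 : MemLp (fun x => G x * k x) 2 m := hF.mono_exponent le_top
    refine ⟨hF.toLp, ⟨hF2.toLp, mul_mem_H2_of_tendsto hw hbA hbG hk
      (Filter.Eventually.of_forall hkw) hF2.coeFn_toLp, ?_⟩, hF.coeFn_toLp⟩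
    exact hF.coeFn_toLp.trans hF2.coeFn_toLp.symm
  obtain ⟨F₁, hF₁, hF₁'⟩ := hone f hf fun x => by
    rw [hwc]; nlinarith [sq_nonneg ‖g x‖]
  obtain ⟨F₂, hF₂, hF₂'⟩ := hone g hg fun x => by
    rw [hwc]; nlinarith [sq_nonneg ‖f x‖]
  have e := ContinuousMap.coeFn_toLp (p := 2) (𝕜 := ℂ) m (1 : C(X, ℂ))
  refine ⟨hG2.toLp, mul_mem_H2_of_tendsto (f := ContinuousMap.toLp 2 m ℂ 1) hw hbA hbG
    (toLp_mem_H2 A.one_mem) ?_ ?_, ?_, F₁, F₂, hF₁, hF₂, ?_, ?_⟩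
  · filter_upwards [e] with x hx
    rw [hx]
    simpa using hw1 x
  · filter_upwards [e, hG2.coeFn_toLp] with x hx hx2
    rw [hx, hx2]
    simp
  · rw [integral_congr_ae hG2.coeFn_toLp, hG1]
  · filter_upwards [hF₁', hG2.coeFn_toLp] with x h1 h2
    rw [h1, h2]
  · filter_upwards [hF₂', hG2.coeFn_toLp] with x h1 h2
    rw [h1, h2]

/-- Multiplication by a bounded function in `H²(m)`, as an operator on `H²(m)`. -/
def mulH2 (h : Lp ℂ ∞ m) (hh : ∃ K ∈ H2 A m, h =ᵐ[m] K) : ↥(H2 A m) →L[ℂ] ↥(H2 A m) :=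
  ((mulLp h).comp (H2 A m).subtypeL).codRestrict (H2 A m) fun f =>
    mulLp_mem_H2 hh.choose_spec.1 hh.choose_spec.2 f.2

lemma coeFn_mulH2 (h : Lp ℂ ∞ m) (hh : ∃ K ∈ H2 A m, h =ᵐ[m] K) (f : ↥(H2 A m)) :
    ((mulH2 h hh f : Lp ℂ 2 m) : X → ℂ) =ᵐ[m] fun x => h x * (f : Lp ℂ 2 m) x :=
  coeFn_mulLp h f

lemma mulH2_mem_multiplicationOperators [T2Space X] (hm : IsCoreMeasure A φ m) (h : Lp ℂ ∞ m)
    (hh : ∃ K ∈ H2 A m, h =ᵐ[m] K) : mulH2 h hh ∈ multiplicationOperators A m :=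
  ⟨h, mem_HInfty_of_mem_H2 hm hh.choose_spec.1 hh.choose_spec.2, coeFn_mulH2 h hh⟩

/-- A dense subspace of `H²(m)` contains a function with non-zero mean. -/
lemma exists_integral_ne_zero_of_dense (hm : IsRepresentingMeasure A φ m)
    {D : Submodule ℂ ↥(H2 A m)} (hD : Dense (D : Set ↥(H2 A m))) :
    ∃ f ∈ D, ∫ x, (f : Lp ℂ 2 m) x ∂m ≠ 0 := by
  by_contra! hcon
  have hc : Continuous fun f : ↥(H2 A m) => ∫ x, (f : Lp ℂ 2 m) x ∂m := by
    have := continuous_integral_mul (m := m) (memLp_continuousMap 2 (1 : C(X, ℂ)))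
    simp only [ContinuousMap.one_apply, mul_one] at this
    exact this.comp continuous_subtype_val
  have h := hc.ext_on hD continuous_const hcon
  have h1 := congrFun h (toH2 A m 1)
  have e := ContinuousMap.coeFn_toLp (p := 2) (𝕜 := ℂ) m (1 : C(X, ℂ))
  have h2 : ∫ x, (toH2 A m 1 : Lp ℂ 2 m) x ∂m = ((m.real Set.univ : ℝ) : ℂ) := by
    refine (integral_congr_ae e).trans ?_
    simp
  rw [h2, hm.integral_one] at h1
  norm_num at h1

/-- A map commuting with the multiplication operators satisfies `g · T f = f · T g`. -/
lemma ae_mul_apply_eq [T2Space X] (hA : IsHypoDirichlet A) (hm : IsCoreMeasure A φ m)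
    {D : Submodule ℂ ↥(H2 A m)}
    (hinv : ∀ B ∈ multiplicationOperators A m, ∀ f ∈ D, B f ∈ D) (T : ↥D → ↥(H2 A m))
    (hT : ∀ (B : ↥(H2 A m) →L[ℂ] ↥(H2 A m)) (hB : B ∈ multiplicationOperators A m) (f : ↥D),
      T ⟨B f, hinv B hB f f.2⟩ = B (T f)) (f g : ↥D) :
    ∀ᵐ x ∂m, ((f : ↥(H2 A m)) : Lp ℂ 2 m) x * (T g : Lp ℂ 2 m) x
      = ((g : ↥(H2 A m)) : Lp ℂ 2 m) x * (T f : Lp ℂ 2 m) x := by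
  obtain ⟨G, hG, hG1, F₁, F₂, hF₁, hF₂, e₁, e₂⟩ :=
    exists_common_denominator hm (f : ↥(H2 A m)).2 (g : ↥(H2 A m)).2
  have hG0 := ae_ne_zero_of_integral_ne_zero hA hm.1 hG (by rw [hG1]; exact one_ne_zero)
  have hB₁ := mulH2_mem_multiplicationOperators hm F₁ hF₁
  have hB₂ := mulH2_mem_multiplicationOperators hm F₂ hF₂
  -- Both sides are `G f g`. Applying `T`, without using additivity, gives `G f · T g = G g · T f`,
  -- and `G` cancels.
  have hfg : mulH2 F₁ hF₁ (g : ↥(H2 A m)) = mulH2 F₂ hF₂ (f : ↥(H2 A m)) := by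
    refine Subtype.ext (Lp.ext ?_)
    filter_upwards [coeFn_mulH2 F₁ hF₁ (g : ↥(H2 A m)), coeFn_mulH2 F₂ hF₂ (f : ↥(H2 A m)), e₁, e₂]
      with x h1 h2 h3 h4
    rw [h1, h2, h3, h4]
    ring
  have hTT : mulH2 F₁ hF₁ (T g) = mulH2 F₂ hF₂ (T f) := by
    rw [← hT _ hB₁, ← hT _ hB₂]
    exact congrArg T (Subtype.ext hfg)
  have h5 := coeFn_mulH2 F₁ hF₁ (T g)
  rw [hTT] at h5
  filter_upwards [h5, coeFn_mulH2 F₂ hF₂ (T f), e₁, e₂, hG0] with x h1 h2 h3 h4 h0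
  rw [h1, h3, h4, mul_assoc, mul_assoc] at h2
  exact mul_left_cancel₀ h0 h2

/-- An operator given by multiplication with a quotient `f₁ / f₂` is closable. -/
lemma isClosable_of_ae_eq_div {D : Submodule ℂ ↥(H2 A m)} (L : ↥D →ₗ[ℂ] ↥(H2 A m))
    {f₁ f₂ : Lp ℂ ∞ m} (hf₂ : ∀ᵐ x ∂m, f₂ x ≠ 0)
    (hL : ∀ f : ↥D, ((L f : Lp ℂ 2 m) : X → ℂ) =ᵐ[m]
      fun x => f₁ x / f₂ x * ((f : ↥(H2 A m)) : Lp ℂ 2 m) x) :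
    (LinearPMap.mk D L).IsClosable := by
  -- The relation `f₂ v = f₁ u` is closed and contains the graph; over `u = 0` it forces `v = 0`
  -- because `f₂` vanishes almost nowhere.
  have hcl : IsClosed {p : ↥(H2 A m) × ↥(H2 A m) | mulLp f₂ p.2 = mulLp f₁ p.1} :=
    isClosed_eq ((mulLp f₂).continuous.comp (continuous_subtype_val.comp continuous_snd))
      ((mulLp f₁).continuous.comp (continuous_subtype_val.comp continuous_fst))
  have hgraph : ∀ p ∈ (LinearPMap.mk D L).graph.topologicalClosure,
      mulLp f₂ p.2 = mulLp f₁ p.1 := by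
    intro p hp
    refine closure_minimal (fun q hq => ?_) hcl hp
    obtain ⟨f, hf1, hf2⟩ := (LinearPMap.mem_graph_iff _).1 hq
    have hf2' : L f = q.2 := hf2
    refine Lp.ext ?_
    filter_upwards [coeFn_mulLp f₂ (q.2 : Lp ℂ 2 m), coeFn_mulLp f₁ (q.1 : Lp ℂ 2 m), hL f, hf₂]
      with x h1 h2 h3 h4
    rw [h1, h2, ← hf2', h3, ← hf1]
    field_simp
  refine ⟨(LinearPMap.mk D L).graph.topologicalClosure.toLinearPMap,
    (Submodule.toLinearPMap_graph_eq _ fun p hp hp0 => ?_).symm⟩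
  have h := hgraph p hp
  rw [hp0, ZeroMemClass.coe_zero, map_zero] at h
  refine Subtype.ext (Lp.ext ?_)
  have h1 := coeFn_mulLp f₂ (p.2 : Lp ℂ 2 m)
  rw [h] at h1
  filter_upwards [h1, Lp.coeFn_zero ℂ 2 m, hf₂] with x h2 h3 h4
  rw [h3] at h2
  rw [ZeroMemClass.coe_zero, h3]
  simpa [h4] using h2.symm

end Quotients

end HypoDirichlet

end

/-! ### The quotient representation of `T`. -/

theorem proposition3p3 {X : Type*} [TopologicalSpace X] [CompactSpace X] [T2Space X]
    [MeasurableSpace X] [BorelSpace X]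
    (A : Subalgebra ℂ C(X, ℂ)) (hA : HypoDirichlet.IsHypoDirichlet A)
    (φ : ↥A →ₐ[ℂ] ℂ) (m : Measure X) [IsFiniteMeasure m]
    (hm : HypoDirichlet.IsCoreMeasure A φ m)
    (hker : HypoDirichlet.IsReproducingKernelHilbertSpace A m)
    (𝒜 : Subalgebra ℂ (↥(HypoDirichlet.H2 A m) →L[ℂ] ↥(HypoDirichlet.H2 A m)))
    (h𝒜 : HypoDirichlet.multiplicationOperators A m ⊆ 𝒜)
    (D : Submodule ℂ ↥(HypoDirichlet.H2 A m))
    (hD : Dense (D : Set ↥(HypoDirichlet.H2 A m)))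
    (hinv : ∀ B ∈ 𝒜, ∀ f ∈ D, B f ∈ D)
    (T : ↥D → ↥(HypoDirichlet.H2 A m))
    (hT : ∀ (B : ↥(HypoDirichlet.H2 A m) →L[ℂ] ↥(HypoDirichlet.H2 A m)) (hB : B ∈ 𝒜) (f : ↥D),
      T ⟨B f, hinv B hB f f.2⟩ = B (T f)) :
    (∃ f₁ ∈ HypoDirichlet.HInfty A m, ∃ f₂ ∈ HypoDirichlet.HInfty A m,
      (∀ᵐ x ∂m, f₂ x ≠ 0) ∧
      ∀ f : ↥D, ((T f : Lp ℂ 2 m) : X → ℂ) =ᵐ[m]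
        fun x => f₁ x / f₂ x * ((f : ↥(HypoDirichlet.H2 A m)) : Lp ℂ 2 m) x) ∧
    ∃ L : ↥D →ₗ[ℂ] ↥(HypoDirichlet.H2 A m),
      (∀ f : ↥D, L f = T f) ∧ LinearPMap.IsClosable (LinearPMap.mk D L) := by

  have hinv' : ∀ B ∈ HypoDirichlet.multiplicationOperators A m, ∀ f ∈ D, B f ∈ D :=
    fun B hB => hinv B (h𝒜 hB)
  have hcomm := HypoDirichlet.ae_mul_apply_eq hA hm hinv' T fun B hB => hT B (h𝒜 hB)
  obtain ⟨f₀, hf₀D, hf₀⟩ := HypoDirichlet.exists_integral_ne_zero_of_dense hm.1 hD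
  have hne := HypoDirichlet.ae_ne_zero_of_integral_ne_zero hA hm.1 f₀.2 hf₀
  -- The symbol `T f₀ / f₀` is a quotient of `H²(m)` functions; multiplying both by `G` puts
  -- numerator and denominator in `H^∞(m)`.
  obtain ⟨G, hG, hG1, F₁, F₂, ⟨K₁, hK₁, hFK₁⟩, ⟨K₂, hK₂, hFK₂⟩, e₁, e₂⟩ :=
    HypoDirichlet.exists_common_denominator hm (T ⟨f₀, hf₀D⟩).2 f₀.2
  have hG0 := HypoDirichlet.ae_ne_zero_of_integral_ne_zero hA hm.1 hG
    (by rw [hG1]; exact one_ne_zero)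
  have hF₂ : ∀ᵐ x ∂m, F₂ x ≠ 0 := by
    filter_upwards [e₂, hG0, hne] with x h1 h2 h3
    rw [h1]
    exact mul_ne_zero h2 h3
  have hmain : ∀ f : ↥D, ((T f : Lp ℂ 2 m) : X → ℂ) =ᵐ[m]
      fun x => F₁ x / F₂ x * ((f : ↥(HypoDirichlet.H2 A m)) : Lp ℂ 2 m) x := by
    intro f
    filter_upwards [hcomm ⟨f₀, hf₀D⟩ f, e₁, e₂, hG0, hne] with x h1 h2 h3 h4 h5
    rw [h2, h3, mul_div_mul_left _ _ h4, div_mul_eq_mul_div, eq_div_iff h5, mul_comm, h1,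
      mul_comm]
  refine ⟨⟨F₁, HypoDirichlet.mem_HInfty_of_mem_H2 hm hK₁ hFK₁, F₂,
    HypoDirichlet.mem_HInfty_of_mem_H2 hm hK₂ hFK₂, hF₂, hmain⟩, ?_⟩
  -- Linearity is read off from the multiplication formula.
  let L : ↥D →ₗ[ℂ] ↥(HypoDirichlet.H2 A m) :=
    { toFun := T
      map_add' := fun f g => by
        refine Subtype.ext (Lp.ext ?_)
        filter_upwards [hmain (f + g), hmain f, hmain g,
          Lp.coeFn_add ((f : ↥(HypoDirichlet.H2 A m)) : Lp ℂ 2 m) (g : ↥(HypoDirichlet.H2 A m)),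
          Lp.coeFn_add (T f : Lp ℂ 2 m) (T g)] with x h1 h2 h3 h4 h5
        rw [h1, Submodule.coe_add, Submodule.coe_add, Submodule.coe_add, h4, h5, Pi.add_apply,
          Pi.add_apply, h2, h3, mul_add]
      map_smul' := fun c f => by
        refine Subtype.ext (Lp.ext ?_)
        filter_upwards [hmain (c • f), hmain f,
          Lp.coeFn_smul c ((f : ↥(HypoDirichlet.H2 A m)) : Lp ℂ 2 m),
          Lp.coeFn_smul c (T f : Lp ℂ 2 m)] with x h1 h2 h4 h5
        rw [h1, RingHom.id_apply, Submodule.coe_smul, Submodule.coe_smul, Submodule.coe_smul, h4,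
          h5, Pi.smul_apply, Pi.smul_apply, h2, smul_eq_mul, smul_eq_mul, mul_left_comm] }
  exact ⟨L, fun _ => rfl, HypoDirichlet.isClosable_of_ae_eq_div L hF₂ hmain⟩
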